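/- Let $\mathbb F$ be a field or skew field with an involution $a\mapsto\tilde a$ (a map with $\widetilde{a+b}=\tilde a+\tilde b$, $\widetilde{ab}=\tilde b\,\tilde a$, $\tilde{\tilde a}=a$; it may be the identity if $\mathbb F$ is a field). For a matrix $A=[a_{ij}]$ over $\mathbb F$ let $A^*=[\tilde a_{ji}]$. Square matrices $A,B$ are \emph{*congruent} if $S^*AS=B$ for some nonsingular $S$. Let $J_n$ be the $n\times n$ nilpotent upper Jordan block, and let $A^{[k]}$ be the direct sum of $k$ copies of $A$. A $0\times 0$ matrix is nonsingular. \textbf{Regularization algorithm.} One \emph{stage} of the algorithm, applied to a singular square matrix $A$, is as follows. (Step 1) Choose a nonsingular $S$ such that the bottom $m_1$ rows of $SA$ are zero and the remaining top rows are (left) linearly independent, and write $$SAS^*=\begin{bmatrix} M& N\\ 0&0_{m_1}\end{bmatrix}$$ with $M$ square. (Step 2) Choose a nonsingular $R$ such that $RN=\begin{bmatrix}0\\E\end{bmatrix}$, where $E$ has $m_2$ rows and they are linearly independent, and let $A_{(1)}$ be the upper left block of $RMR^*=\begin{bmatrix}A_{(1)}&B\\C&D\end{bmatrix}$, where $D$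 is $m_2\times m_2$. If $A_{(1)}$ is singular, the next stage is applied to it and gives $m_3,m_4,A_{(2)}$, and so on; the algorithm stops after $\tau$ stages, when $A_{(\tau)}$ is nonsingular. \textbf{Theorem (Regularizing Decomposition).} Let $A$ be a singular square matrix over $\mathbb F$. The regularization algorithm can be performed on $A$ and terminates; let $\tau$, $m_1,\dots,m_{2\tau}$ and the nonsingular matrix $A_{(\tau)}$ be the result of any execution of it. Then $m_1\ge m_2\ge\dots\ge m_{2\tau}\ge 0$. The numbers $\tau,m_1,\dots,m_{2\tau}$ and the *congruence class of $A_{(\tau)}$ are *congruence invariants of $A$: any execution of the algorithm on any matrix *congruent to $A$ (in particular on $A$) gives the same numbers and a matrix *congruent to $A_{(\tau)}$. Moreover: (a) (Canonical sparse form) $A$ is *congruent to $A_{(\tau)}\oplus N$, where $$N=\begin{bmatrix} 0_{m_{2\tau}}&[I_{m_{2\tau}}\;0]& & & \\ &0_{m_{2\tau-1}}&[I_{m_{2\tau-1}}\;0]& & \\ & &\ddots&\ddots& \\ & & &0_{m_2}&[I_{m_2}\;0]\\ & & & &0_{m_1}\end{bmatrix},$$ each block $[I_{m_k}\;0]$ being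 $m_k\times m_{k-1}$, $k=2,\dots,2\tau$, and all other blocks being zero. (b) (Existence) $A$ is *congruent to $A_{(\tau)}\oplus M$, where $$M=J_1^{[m_1-m_2]}\oplus J_2^{[m_2-m_3]}\oplus\cdots\oplus J_{2\tau-1}^{[m_{2\tau-1}-m_{2\tau}]}\oplus J_{2\tau}^{[m_{2\tau}]}.$$ (c) (Uniqueness) If $A$ is *congruent to $B\oplus C$, where $B$ is nonsingular and $C$ is a direct sum of nilpotent Jordan blocks (of sizes at least $1$), then $B$ is *congruent to $A_{(\tau)}$ and some permutation of the direct summands of $C$ gives $M$. (d) (Unitarily reduced form) Consider the cases ($\alpha$) $\mathbb F=\mathbb C$ with complex conjugation, ($\beta$) $\mathbb F=\mathbb C$ with the identity involution, ($\gamma$) $\mathbb F=\mathbb R$ with the identity involution. Then there is, respectively, ($\alpha$) a unitary $U$, ($\beta$) a unitary $V$, ($\gamma$) a real orthogonal $Q$ such that, respectively, $X=U^*AU$, $X=V^TAV$, $X=Q^TAQ$ has the following form. $X$ is partitioned into $2\tau+1$ block rows and block columns, labelled $2\tau+1,2\tau,\dots,2,1$ from top to bottom and from left to right; for $i\le 2\tau$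 the block row and the block column with label $i$ have size $m_i$, and the diagonal blocks are square. Writing $X_{ij}$ for the block in the block row labelled $i$ and the block column labelled $j$: \begin{itemize} \item $X_{2\tau+1,2\tau+1}=B_{2\tau+1}$ is nonsingular, and it is equivalent to $A_{(\tau)}$ under, respectively, complex *congruence, complex $T$-congruence, real $T$-congruence; \item $X_{i,i-1}=B_i$ has linearly independent rows for $i=2,\dots,2\tau$; \item $X_{ij}=0$ if $i$ is odd, $i<2\tau$ and $i\le j$; and $X_{ij}=0$ if $j$ is odd, $j<2\tau$ and $i>j+1$; \item the remaining blocks (``stars'') are arbitrary. \end{itemize} The principal submatrix of $X$ obtained by deleting the block row and the block column that contain $B_{2\tau+1}$ becomes the matrix $N$ of (a) when all star blocks are replaced by zero blocks and each $B_i$ is replaced by $[I\;0]$. -/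

import Mathlib

open scoped Matrix

namespace Regularization

section Basic

variable {F : Type*} [DivisionRing F] [StarRing F]

/-- `A` and `B` are *congruent: `Sᴴ * A * S = B` for some nonsingular `S`. The index sets of `A`
and `B` may be different (for instance, a matrix and a block matrix); `S` is then an invertible
matrix with rows indexed by `α` and columns indexed by `β`, which over a skew field forces `α` and
`β` to have the same number of elements. -/
def StarCongruent {α β : Type*} [Fintype α] [DecidableEq α] [Fintype β] [DecidableEq β]
    (A : Matrix α α F) (B : Matrix β β F) : Prop :=
  ∃ (S : Matrix α β F) (T : Matrix β α F), S * T = 1 ∧ T * S = 1 ∧ Sᴴ * A * S = B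

/-- One stage of the regularization algorithm, with the result `A₁` and the integers `m₁`, `m₂`.

Step 1: `S` is nonsingular, the top rows of `S * A` are (left) linearly independent and its bottom
`m₁` rows are zero; then `S * A * Sᴴ = [M N; 0 0]` with `M` square and `N` having `m₁` columns.

Step 2: `R` is nonsingular, the top rows of `R * N` are zero and its bottom `m₂` rows are linearly
independent; `A₁` is the upper left block of `R * M * Rᴴ`, whose lower right block is `m₂ × m₂`. -/
def IsStage (r m₂ m₁ : ℕ) (A : Matrix (Fin (r + m₂ + m₁)) (Fin (r + m₂ + m₁)) F)
    (A₁ : Matrix (Fin r) (Fin r) F) : Prop :=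
  ∃ S : Matrix (Fin (r + m₂ + m₁)) (Fin (r + m₂ + m₁)) F, IsUnit S ∧
    LinearIndependent F (fun i : Fin (r + m₂) => (S * A) (Fin.castAdd m₁ i)) ∧
    (∀ i : Fin m₁, (S * A) (Fin.natAdd (r + m₂) i) = 0) ∧
    ∃ (M : Matrix (Fin (r + m₂)) (Fin (r + m₂)) F) (N : Matrix (Fin (r + m₂)) (Fin m₁) F),
      M = (S * A * Sᴴ).submatrix (Fin.castAdd m₁) (Fin.castAdd m₁) ∧
      N = (S * A * Sᴴ).submatrix (Fin.castAdd m₁) (Fin.natAdd (r + m₂)) ∧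
      ∃ R : Matrix (Fin (r + m₂)) (Fin (r + m₂)) F, IsUnit R ∧
        (∀ i : Fin r, (R * N) (Fin.castAdd m₂ i) = 0) ∧
        LinearIndependent F (fun i : Fin m₂ => (R * N) (Fin.natAdd r i)) ∧
        A₁ = (R * M * Rᴴ).submatrix (Fin.castAdd m₂) (Fin.castAdd m₂)

/-- `Run A τ [m₁, m₂, …, m_{2τ}] B`: some execution of the regularization algorithm on `A`
terminates after `τ` stages with the nonsingular matrix `B`, having produced the integers
`m₁, …, m_{2τ}`. A stage is performed as long as the current matrix is singular. -/
inductive Run : {n : ℕ} → Matrix (Fin n) (Fin n) F → ℕ → List ℕ →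
    {r : ℕ} → Matrix (Fin r) (Fin r) F → Prop
  | done {n : ℕ} (A : Matrix (Fin n) (Fin n) F) (hA : IsUnit A) : Run A 0 [] A
  | step {r m₂ m₁ τ s : ℕ} {ms : List ℕ}
      (A : Matrix (Fin (r + m₂ + m₁)) (Fin (r + m₂ + m₁)) F)
      (A₁ : Matrix (Fin r) (Fin r) F) (B : Matrix (Fin s) (Fin s) F)
      (hA : ¬ IsUnit A) (hstage : IsStage r m₂ m₁ A A₁) (hrun : Run A₁ τ ms B) :
      Run A (τ + 1) (m₁ :: m₂ :: ms) B

end Basic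

/-- The `k`-th entry `m_k`, `k ≥ 1`, of the list `[m₁, m₂, …]`; it is `0` beyond the end of the
list (so `m_{2τ+1} = 0`). -/
def entry (ms : List ℕ) : ℕ → ℕ
  | 0 => 0
  | k + 1 => ms.getD k 0

/-- Row (and column) positions of a matrix partitioned into `2τ` block rows and block columns
of sizes `m₁, …, m_{2τ}`; the block with first component `k` has size `m_{k+1}` and the label
`k + 1`. In displays the blocks are arranged from the label `2τ` down to the label `1`. -/
abbrev Pos (τ : ℕ) (ms : List ℕ) : Type := Σ k : Fin (2 * τ), Fin (entry ms (k + 1))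

/-- The canonical sparse form `N`: its block in the block row `i` and the block column `i - 1`
(labels) is the `m_i × m_{i-1}` matrix `[I 0]`, for `i = 2, …, 2τ`; all other blocks are zero. -/
def sparseForm (F : Type*) [DivisionRing F] (τ : ℕ) (ms : List ℕ) :
    Matrix (Pos τ ms) (Pos τ ms) F :=
  Matrix.of fun p q =>
    if (p.1 : ℕ) = q.1 + 1 ∧ (p.2 : ℕ) = q.2 then 1 else 0

/-- The `n × n` singular Jordan block `J_n`. -/
def jordanBlock (F : Type*) [DivisionRing F] (n : ℕ) : Matrix (Fin n) (Fin n) F :=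
  Matrix.of fun i j => if (i : ℕ) + 1 = j then 1 else 0

/-- The direct sum `J_{d₁} ⊕ J_{d₂} ⊕ ⋯ ⊕ J_{d_p}` for the list `[d₁, …, d_p]`. -/
def jordanSum (F : Type*) [DivisionRing F] (ds : List ℕ) :
    Matrix (Σ i : Fin ds.length, Fin (ds.get i)) (Σ i : Fin ds.length, Fin (ds.get i)) F :=
  Matrix.blockDiagonal' fun i => jordanBlock F (ds.get i)

/-- The sizes of the summands of `J_1^{[m_1 - m_2]} ⊕ J_2^{[m_2 - m_3]} ⊕ ⋯ ⊕ J_{2τ}^{[m_{2τ}]}`: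
each `k = 1, …, 2τ` is repeated `m_k - m_{k+1}` times, where `m_{2τ+1} = 0`. -/
def jordanSizes (τ : ℕ) (ms : List ℕ) : List ℕ :=
  (List.range (2 * τ)).flatMap fun k =>
    List.replicate (entry ms (k + 1) - entry ms (k + 2)) (k + 1)

/-- The direct sum of two square matrices. -/
abbrev directSum {F α β : Type*} [DivisionRing F] (A : Matrix α α F) (B : Matrix β β F) :
    Matrix (α ⊕ β) (α ⊕ β) F :=
  Matrix.fromBlocks A 0 0 B

/-- The kinds of blocks in the unitarily reduced form: a zero block, an unspecified block
(a star), or one of the distinguished superdiagonal blocks `B_i`. -/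
inductive BlockKind where
  | zero
  | star
  | dist

/-- The kind of the block in position `(i, j)` of the unitarily reduced form. The block rows and
columns have labels `2τ + 1, 2τ, …, 1` in this order (from left to right and from top to bottom),
`2τ + 1` being the one of the regular part. The block `B_i` stands in position `(i, i - 1)`,
for `i = 2, …, 2τ`. A block row with an odd label `i < 2τ` is zero from its beginning up to and
including the diagonal, and a block column with an odd label `j < 2τ` is zero from its top down
to the position above `B_{j+1}`. -/
def blockKind (τ i j : ℕ) : BlockKind :=
  if i = j + 1 ∧ i ≤ 2 * τ then .dist
  else if Odd i ∧ i < 2 * τ ∧ i ≤ j then .zero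
  else if Odd j ∧ j < 2 * τ ∧ j < i then .zero
  else .star

/-- The label of the block row to which a position belongs. -/
def label {r τ : ℕ} {ms : List ℕ} : Fin r ⊕ Pos τ ms → ℕ
  | .inl _ => 2 * τ + 1
  | .inr p => p.1 + 1

/-- `X` has the unitarily reduced form with the parameters `τ, m₁, …, m_{2τ}`, and `B` is its
diagonal block `B_{2τ+1}`: `B` is nonsingular, the zero blocks are zero, and each of the blocks
`B_2, …, B_{2τ}` has linearly independent rows. -/
structure IsReducedForm {F : Type*} [DivisionRing F] {r : ℕ} (τ : ℕ) (ms : List ℕ)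
    (B : Matrix (Fin r) (Fin r) F) (X : Matrix (Fin r ⊕ Pos τ ms) (Fin r ⊕ Pos τ ms) F) :
    Prop where
  regular_block : X.toBlocks₁₁ = B
  regular : IsUnit B
  zero_blocks : ∀ p q, blockKind τ (label p) (label q) = .zero → X p q = 0
  independent_rows : ∀ i j : Fin (2 * τ), (i : ℕ) = j + 1 →
    LinearIndependent F (fun (a : Fin (entry ms (i + 1))) (b : Fin (entry ms (j + 1))) =>
      X (.inr ⟨i, a⟩) (.inr ⟨j, b⟩))

/-- The matrix obtained from `X` by deleting the block row and block column of the regular part,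
replacing every star block by zero and every block `B_i` by `[I 0]`, and keeping the other
blocks. -/
def skeleton {F : Type*} [DivisionRing F] {r τ : ℕ} {ms : List ℕ}
    (X : Matrix (Fin r ⊕ Pos τ ms) (Fin r ⊕ Pos τ ms) F) : Matrix (Pos τ ms) (Pos τ ms) F :=
  Matrix.of fun p q =>
    match blockKind τ (p.1 + 1) (q.1 + 1) with
    | .zero => X (.inr p) (.inr q)
    | .star => 0
    | .dist => if (p.2 : ℕ) = q.2 then 1 else 0

end Regularization

open Regularization

/-! A stage replaces `A` by a *congruent matrix [A₁ B 0; C D E; 0 0 0] in which [A₁ B 0; C D E] and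
E have independent rows (`HasStageForm`). Everything rests on the rigidity of this shape. A
*congruence between two such matrices must respect the left kernel, which the zero rows span, and
then the subspace cut out by the zero above E. Its matrix is therefore block triangular with
invertible diagonal blocks, and the corner of the congruence equation is a *congruence between the
two blocks A₁ (`HasStageForm.unique`). Induction over the stages gives invariance (`Run.unique`).

For the sparse form the induction goes back up: once A₁ has been brought to Aτ ⊕ N, the blocks B, C,
D, E are normalized without disturbing A₁ (`exists_sparseForm_of_stageBlocks`). The independence of
the rows forces the inequalities between the m_k on the way. A permutation of N gives the Jordan
blocks.

For uniqueness, B ⊕ (Jordan blocks) is itself in stage form after a permutation, and its reduced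
block is B ⊕ (the same blocks with sizes lowered by 2). Hence m_k counts the blocks of size at least
k, and these counts determine the sizes (`Run.unique_jordanFamily`).

Termination and the unitary form share one recursion (`ReductionClass.exists_run`), run for a class
of matrices rich enough for row reduction: all nonsingular ones, or only unitary ones. -/

namespace Regularization

open Matrix

/-! ### Independent rows and inverses over a skew field -/

section Rows

variable {F : Type*} [DivisionRing F]

/-- The rows of `M` are (left) linearly independent. -/
abbrev RowIndep {ι κ : Type*} (M : Matrix ι κ F) : Prop :=
  LinearIndependent F (fun i => M i)

theorem rowIndep_iff {ι κ : Type*} [Fintype ι] {M : Matrix ι κ F} :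
    RowIndep M ↔ ∀ v : ι → F, v ᵥ* M = 0 → v = 0 := by
  rw [RowIndep, Fintype.linearIndependent_iff]
  simp only [Matrix.vecMul_eq_sum, funext_iff (f := _) (g := (0 : ι → F)), Pi.zero_apply]

theorem RowIndep.eq_zero_of_mul {ι κ μ : Type*} [Fintype ι] {M : Matrix ι κ F} (h : RowIndep M)
    {P : Matrix μ ι F} (hP : P * M = 0) : P = 0 := by
  ext i j
  have := rowIndep_iff.1 h (P i) (by
    ext k
    exact congrFun (congrFun hP i) k)
  exact congrFun this j

theorem RowIndep.mul_right {ι κ μ : Type*} [Fintype ι] [Fintype κ] [Fintype μ] [DecidableEq κ]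
    {M : Matrix ι κ F} (h : RowIndep M) {S : Matrix κ μ F} {T : Matrix μ κ F} (hST : S * T = 1) :
    RowIndep (M * S) := by
  rw [rowIndep_iff] at h ⊢
  intro v hv
  apply h
  have := congrArg (· ᵥ* T) hv
  simpa [Matrix.mul_assoc, hST] using this

theorem RowIndep.mul_left {ι κ μ : Type*} [Fintype ι] [Fintype μ] [DecidableEq μ]
    {M : Matrix ι κ F} (h : RowIndep M) {S : Matrix μ ι F} {T : Matrix ι μ F} (hST : S * T = 1) :
    RowIndep (S * M) := by
  rw [rowIndep_iff] at h ⊢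
  intro v hv
  rw [← Matrix.vecMul_vecMul] at hv
  have := congrArg (· ᵥ* T) (h _ hv)
  simpa [hST] using this

theorem RowIndep.comp {ι ι' κ : Type*} {M : Matrix ι κ F} (h : RowIndep M) {f : ι' → ι}
    (hf : Function.Injective f) : RowIndep (M.submatrix f id) :=
  LinearIndependent.comp h f hf

theorem RowIndep.reindex {ι ι' κ κ' : Type*} {M : Matrix ι κ F} (h : RowIndep M) {f : ι' → ι}
    (hf : Function.Injective f) (e : κ' ≃ κ) : RowIndep (M.submatrix f e) := by
  have := (h.comp hf).map' (LinearEquiv.funCongrLeft F F e).toLinearMap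
    (LinearEquiv.ker _)
  exact this

theorem RowIndep.fromCols_of_left_zero {ι κ κ' : Type*} [Fintype ι] {A : Matrix ι κ F}
    {B : Matrix ι κ' F} (h : RowIndep (fromCols A B)) (hA : A = 0) : RowIndep B := by
  rw [rowIndep_iff] at h ⊢
  intro v hv
  apply h
  ext j
  rcases j with j | j
  · simp [hA, Matrix.vecMul_fromCols]
  · simp [hv, Matrix.vecMul_fromCols]

theorem RowIndep.fromCols_of_right_zero {ι κ κ' : Type*} [Fintype ι] {A : Matrix ι κ F}
    {B : Matrix ι κ' F} (h : RowIndep (fromCols A B)) (hB : B = 0) : RowIndep A := by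
  rw [rowIndep_iff] at h ⊢
  intro v hv
  apply h
  ext j
  rcases j with j | j
  · simp [hv, Matrix.vecMul_fromCols]
  · simp [hB, Matrix.vecMul_fromCols]

theorem exists_inverse_of_rowIndep {ι κ : Type*} [Fintype ι] [DecidableEq ι] [Fintype κ]
    [DecidableEq κ] {M : Matrix ι κ F} (h : RowIndep M)
    (hcard : Fintype.card ι = Fintype.card κ) : ∃ T : Matrix κ ι F, M * T = 1 ∧ T * M = 1 := by
  let b := basisOfLinearIndependentOfCardEqFinrank' (fun i => M i) h (by simpa using hcard)
  have hb : ∀ i, b i = M i := fun i => by simp [b]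
  have hT : (Matrix.of fun k i => b.repr (Pi.single k 1) i) * M = 1 := by
    ext k l
    have := congrFun (b.sum_repr (Pi.single k 1)) l
    simp only [hb, Finset.sum_apply, Pi.smul_apply, smul_eq_mul] at this
    simp only [Matrix.mul_apply, Matrix.of_apply, this, Matrix.one_apply, Pi.single_apply]
    simp [eq_comm]
  refine ⟨_, ?_, hT⟩
  have : (M * (Matrix.of fun k i => b.repr (Pi.single k 1) i) - 1) * M = 0 := by
    rw [Matrix.sub_mul, Matrix.mul_assoc, hT]; simp
  exact sub_eq_zero.1 (h.eq_zero_of_mul this)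

theorem isUnit_iff_exists_inverse {ι : Type*} [Fintype ι] [DecidableEq ι] {A : Matrix ι ι F} :
    IsUnit A ↔ ∃ B, A * B = 1 ∧ B * A = 1 :=
  isUnit_iff_exists

theorem isUnit_of_rowIndep {ι : Type*} [Fintype ι] [DecidableEq ι] {A : Matrix ι ι F}
    (h : RowIndep A) : IsUnit A :=
  isUnit_iff_exists_inverse.2 (exists_inverse_of_rowIndep h rfl)

theorem rowIndep_of_mul_eq_one {ι κ : Type*} [Fintype ι] [DecidableEq ι] [Fintype κ]
    {A : Matrix ι κ F} {B : Matrix κ ι F} (h : A * B = 1) : RowIndep A := by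
  rw [rowIndep_iff]
  intro v hv
  have := congrArg (· ᵥ* B) hv
  simpa [h] using this

theorem card_eq_of_mul_eq_one {ι κ : Type*} [Fintype ι] [DecidableEq ι] [Fintype κ]
    [DecidableEq κ] {A : Matrix ι κ F} {B : Matrix κ ι F} (h : A * B = 1) (h' : B * A = 1) :
    Fintype.card ι = Fintype.card κ :=
  Matrix.square_of_invertible A B h h'

end Rows

/-! ### *Congruence as an equivalence relation -/

section Congruence

variable {F : Type*} [DivisionRing F] [StarRing F]

theorem conjTranspose_mul_eq_one {α β : Type*} [Fintype β] [DecidableEq α]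
    {S : Matrix α β F} {T : Matrix β α F} (h : S * T = 1) : Tᴴ * Sᴴ = 1 := by
  rw [← Matrix.conjTranspose_mul, h, Matrix.conjTranspose_one]

variable {α β γ δ : Type*} [Fintype α] [DecidableEq α] [Fintype β] [DecidableEq β]
  [Fintype γ] [DecidableEq γ] [Fintype δ] [DecidableEq δ]

theorem starCongruent_of_left {A : Matrix α α F} {B : Matrix β β F} (P : Matrix β α F)
    (Q : Matrix α β F) (h : P * Q = 1) (h' : Q * P = 1) (hB : P * A * Pᴴ = B) :
    StarCongruent A B :=
  ⟨Pᴴ, Qᴴ, conjTranspose_mul_eq_one h', conjTranspose_mul_eq_one h, by simpa using hB⟩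

theorem StarCongruent.exists_left {A : Matrix α α F} {B : Matrix β β F} (h : StarCongruent A B) :
    ∃ (P : Matrix β α F) (Q : Matrix α β F), P * Q = 1 ∧ Q * P = 1 ∧ P * A * Pᴴ = B ∧
      Q * B * Qᴴ = A := by
  obtain ⟨S, T, h, h', rfl⟩ := h
  have h₁ := conjTranspose_mul_eq_one h
  refine ⟨Sᴴ, Tᴴ, conjTranspose_mul_eq_one h', h₁, by simp, ?_⟩
  calc Tᴴ * (Sᴴ * A * S) * Tᴴᴴ = (Tᴴ * Sᴴ) * A * (S * T) := by
        simp only [Matrix.mul_assoc, Matrix.conjTranspose_conjTranspose]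
    _ = A := by simp [h, h₁]

theorem StarCongruent.symm {A : Matrix α α F} {B : Matrix β β F} (h : StarCongruent A B) :
    StarCongruent B A := by
  obtain ⟨P, Q, h, h', -, hA⟩ := h.exists_left
  exact starCongruent_of_left Q P h' h hA

theorem StarCongruent.refl (A : Matrix α α F) : StarCongruent A A :=
  ⟨1, 1, by simp, by simp, by simp⟩

theorem StarCongruent.trans {A : Matrix α α F} {B : Matrix β β F} {C : Matrix γ γ F}
    (h : StarCongruent A B) (h' : StarCongruent B C) : StarCongruent A C := by
  obtain ⟨S, T, h₁, h₂, rfl⟩ := h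
  obtain ⟨S', T', h₃, h₄, rfl⟩ := h'
  refine ⟨S * S', T' * T, ?_, ?_, ?_⟩
  · rw [Matrix.mul_assoc, ← Matrix.mul_assoc S', h₃, Matrix.one_mul, h₁]
  · rw [Matrix.mul_assoc, ← Matrix.mul_assoc T, h₂, Matrix.one_mul, h₄]
  · simp only [Matrix.conjTranspose_mul, Matrix.mul_assoc]

theorem starCongruent_submatrix (A : Matrix α α F) (e : β ≃ α) :
    StarCongruent A (A.submatrix e e) := by
  refine starCongruent_of_left ((1 : Matrix α α F).submatrix e id)
    ((1 : Matrix α α F).submatrix id e) ?_ ?_ ?_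
  · ext i j; simp [Matrix.mul_apply, Matrix.one_apply]
  · ext i j
    have := e.sum_comp (fun x => (1 : Matrix α α F) i x * (1 : Matrix α α F) x j)
    rw [← Matrix.mul_apply, Matrix.one_mul] at this
    exact this
  · ext i j; simp [Matrix.mul_apply, Matrix.one_apply]

theorem StarCongruent.directSum {A : Matrix α α F} {B : Matrix β β F} {C : Matrix γ γ F}
    {D : Matrix δ δ F} (h : StarCongruent A B) (h' : StarCongruent C D) :
    StarCongruent (directSum A C) (directSum B D) := by
  obtain ⟨S, T, h₁, h₂, rfl⟩ := h
  obtain ⟨S', T', h₃, h₄, rfl⟩ := h'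
  refine ⟨fromBlocks S 0 0 S', fromBlocks T 0 0 T', ?_, ?_, ?_⟩ <;>
    simp [Matrix.fromBlocks_multiply, Matrix.fromBlocks_conjTranspose, h₁, h₂, h₃, h₄]

theorem StarCongruent.isUnit {A : Matrix α α F} {B : Matrix β β F} (h : StarCongruent A B)
    (hA : IsUnit A) : IsUnit B := by
  rw [isUnit_iff_exists_inverse] at hA ⊢
  obtain ⟨C, hC, hC'⟩ := hA
  obtain ⟨S, T, h₁, h₂, rfl⟩ := h
  have h₃ := conjTranspose_mul_eq_one h₁
  have h₄ := conjTranspose_mul_eq_one h₂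
  refine ⟨T * C * Tᴴ, ?_, ?_⟩
  · calc Sᴴ * A * S * (T * C * Tᴴ) = Sᴴ * A * (S * T) * C * Tᴴ := by simp only [Matrix.mul_assoc]
      _ = 1 := by rw [h₁, Matrix.mul_one, Matrix.mul_assoc Sᴴ, hC, Matrix.mul_one, h₄]
  · calc T * C * Tᴴ * (Sᴴ * A * S) = T * C * (Tᴴ * Sᴴ) * A * S := by simp only [Matrix.mul_assoc]
      _ = 1 := by rw [h₃, Matrix.mul_one, Matrix.mul_assoc T, hC', Matrix.mul_one, h₂]

end Congruence

/-! ### Rigidity of the stage form -/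

section Blocks

variable {F : Type*} [DivisionRing F]

/-- The block matrix `[K B 0; C D E; 0 0 0]` obtained by a stage of the algorithm. -/
abbrev stageBlocks {α β γ : Type*} (K : Matrix α α F) (B : Matrix α β F) (C : Matrix β α F)
    (D : Matrix β β F) (E : Matrix β γ F) : Matrix ((α ⊕ β) ⊕ γ) ((α ⊕ β) ⊕ γ) F :=
  fromBlocks (fromBlocks K B C D) (fromRows 0 E) 0 0

variable [StarRing F]

/-- `A` is *congruent to a block matrix `[A₁ B 0; C D E; 0 0 0]` (with block sizes given by `α`,
`β` and `γ`) such that the rows of `[A₁ B 0; C D E]` and those of `E` are independent. -/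
def HasStageForm {ι α : Type*} (β γ : Type*) [Fintype ι] [DecidableEq ι] [Fintype α]
    [DecidableEq α] [Fintype β] [DecidableEq β] [Fintype γ] [DecidableEq γ]
    (A : Matrix ι ι F) (A₁ : Matrix α α F) : Prop :=
  ∃ (B : Matrix α β F) (C : Matrix β α F) (D : Matrix β β F) (E : Matrix β γ F),
    StarCongruent A (stageBlocks A₁ B C D E) ∧
    RowIndep (fromCols (fromBlocks A₁ B C D) (fromRows (0 : Matrix α γ F) E)) ∧ RowIndep E

theorem exists_fromBlocks {F a b c d : Type*} (P : Matrix (a ⊕ b) (c ⊕ d) F) :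
    ∃ (P₁ : Matrix a c F) (P₂ : Matrix a d F) (P₃ : Matrix b c F) (P₄ : Matrix b d F),
      P = fromBlocks P₁ P₂ P₃ P₄ :=
  ⟨_, _, _, _, (Matrix.fromBlocks_toBlocks P).symm⟩

/-- Cancelling `Pᴴ` turns the congruence into P [M N; 0 0] = [M' N'; 0 0] Qᴴ. The lower rows on the
right vanish, so the lower left block of `P` annihilates the independent rows [M N]. -/
theorem lower_left_eq_zero {a c a' c' : Type*} [Fintype a] [DecidableEq a] [Fintype c]
    [DecidableEq c] [Fintype a'] [DecidableEq a'] [Fintype c'] [DecidableEq c']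
    {M : Matrix a a F} {N : Matrix a c F} {M' : Matrix a' a' F} {N' : Matrix a' c' F}
    (h : RowIndep (fromCols M N)) {P : Matrix (a' ⊕ c') (a ⊕ c) F}
    {Q : Matrix (a ⊕ c) (a' ⊕ c') F} (hQP : Q * P = 1)
    (hPX : P * (fromBlocks M N 0 0 : Matrix (a ⊕ c) (a ⊕ c) F) * Pᴴ =
      (fromBlocks M' N' 0 0 : Matrix (a' ⊕ c') (a' ⊕ c') F)) : P.toBlocks₂₁ = 0 := by
  have h₁ : P * (fromBlocks M N 0 0 : Matrix (a ⊕ c) (a ⊕ c) F) =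
      (fromBlocks M' N' 0 0 : Matrix (a' ⊕ c') (a' ⊕ c') F) * Qᴴ := by
    rw [← hPX, Matrix.mul_assoc _ Pᴴ, conjTranspose_mul_eq_one hQP, Matrix.mul_one]
  rw [← Matrix.fromBlocks_toBlocks P, ← Matrix.fromBlocks_toBlocks Qᴴ,
    Matrix.fromBlocks_multiply, Matrix.fromBlocks_multiply, Matrix.fromBlocks_inj] at h₁
  apply h.eq_zero_of_mul
  rw [Matrix.mul_fromCols]
  have h₂ : P.toBlocks₂₁ * M = 0 := by simpa using h₁.2.2.1
  have h₃ : P.toBlocks₂₁ * N = 0 := by simpa using h₁.2.2.2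
  rw [h₂, h₃, Matrix.fromCols_zero]

/-- After `Lᴴ` is cancelled, the upper rows of the equation say that the upper right block of `R`
annihilates `E`. -/
theorem upper_right_eq_zero {x y z x' y' z' : Type*} [Fintype x] [Fintype y] [Fintype z]
    [DecidableEq z] [Fintype z'] {E : Matrix y z F} {E' : Matrix y' z' F} (hE : RowIndep E)
    {R : Matrix (x' ⊕ y') (x ⊕ y) F} {L : Matrix z' z F} {L' : Matrix z z' F} (hL : L' * L = 1)
    (hR : R * fromRows (0 : Matrix x z F) E * Lᴴ = fromRows (0 : Matrix x' z' F) E') :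
    R.toBlocks₁₂ = 0 := by
  have h₁ : R * fromRows (0 : Matrix x z F) E = fromRows (0 : Matrix x' z' F) E' * L'ᴴ := by
    rw [← hR, Matrix.mul_assoc _ Lᴴ, ← Matrix.conjTranspose_mul, hL,
      Matrix.conjTranspose_one, Matrix.mul_one]
  apply hE.eq_zero_of_mul
  rw [← Matrix.fromBlocks_toBlocks R, Matrix.fromBlocks_mul_fromRows,
    Matrix.fromRows_mul, Matrix.fromRows_ext_iff] at h₁
  simpa using h₁.1

theorem HasStageForm.unique {ι ι' α α' β β' γ γ' : Type*} [Fintype ι] [DecidableEq ι]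
    [Fintype ι'] [DecidableEq ι'] [Fintype α] [DecidableEq α] [Fintype β] [DecidableEq β]
    [Fintype γ] [DecidableEq γ] [Fintype α'] [DecidableEq α'] [Fintype β'] [DecidableEq β']
    [Fintype γ'] [DecidableEq γ'] {A : Matrix ι ι F} {A₁ : Matrix α α F} {A' : Matrix ι' ι' F}
    {A₁' : Matrix α' α' F} (h : HasStageForm β γ A A₁) (h' : HasStageForm β' γ' A' A₁')
    (hA : StarCongruent A A') :
    StarCongruent A₁ A₁' ∧ Fintype.card β = Fintype.card β' ∧
      Fintype.card γ = Fintype.card γ' := by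
  obtain ⟨B, C, D, E, hc, hr, hE⟩ := h
  obtain ⟨B', C', D', E', hc', hr', hE'⟩ := h'
  -- The inverse `Q` is a congruence in the other direction, so it has the same triangular shape;
  -- this makes the diagonal blocks of `P` invertible.
  obtain ⟨P, Q, hPQ, hQP, hP, hQ⟩ := ((hc.symm.trans hA).trans hc').exists_left
  have hP₃ := lower_left_eq_zero hr hQP hP
  have hQ₃ := lower_left_eq_zero hr' hPQ hQ
  obtain ⟨P₁, P₂, P₃, P₄, rfl⟩ := exists_fromBlocks P
  obtain ⟨Q₁, Q₂, Q₃, Q₄, rfl⟩ := exists_fromBlocks Q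
  rw [Matrix.toBlocks_fromBlocks₂₁] at hP₃ hQ₃
  subst hP₃ hQ₃
  rw [← Matrix.fromBlocks_one, Matrix.fromBlocks_multiply, Matrix.fromBlocks_inj] at hPQ hQP
  simp only [Matrix.mul_zero, Matrix.zero_mul, add_zero, zero_add] at hPQ hQP
  obtain ⟨hPQ₁, -, -, hPQ₄⟩ := hPQ
  obtain ⟨hQP₁, -, -, hQP₄⟩ := hQP
  simp only [stageBlocks, Matrix.fromBlocks_conjTranspose, Matrix.fromBlocks_multiply,
    Matrix.fromBlocks_inj, Matrix.mul_zero, Matrix.zero_mul, add_zero, zero_add,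
    Matrix.conjTranspose_zero] at hP hQ
  have hR := upper_right_eq_zero hE hQP₄ hP.2.1
  have hR' := upper_right_eq_zero hE' hPQ₄ hQ.2.1
  refine ⟨?_, ?_, card_eq_of_mul_eq_one hQP₄ hPQ₄⟩
  all_goals
    obtain ⟨R₁, R₂, R₃, R₄, rfl⟩ := exists_fromBlocks P₁
    obtain ⟨T₁, T₂, T₃, T₄, rfl⟩ := exists_fromBlocks Q₁
    rw [Matrix.toBlocks_fromBlocks₁₂] at hR hR'
    subst hR hR'
    rw [← Matrix.fromBlocks_one, Matrix.fromBlocks_multiply, Matrix.fromBlocks_inj] at hPQ₁ hQP₁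
    simp only [Matrix.mul_zero, Matrix.zero_mul, add_zero, zero_add] at hPQ₁ hQP₁
  -- The upper rows of `P₁ * N` vanish, so `P₂` contributes nothing to the corner, and what is left
  -- is R₁ A₁ R₁ᴴ = A₁'.
  · rw [← Matrix.fromRows_toRows P₂] at hP
    simp only [Matrix.fromBlocks_mul_fromRows, Matrix.fromBlocks_multiply,
      Matrix.conjTranspose_fromRows_eq_fromCols_conjTranspose, Matrix.fromRows_mul_fromCols,
      Matrix.fromBlocks_conjTranspose, Matrix.fromBlocks_add, Matrix.fromBlocks_inj,
      Matrix.mul_zero, Matrix.zero_mul, add_zero, zero_add, Matrix.conjTranspose_zero] at hP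
    exact starCongruent_of_left R₁ T₁ hPQ₁.1 hQP₁.1 hP.1.1
  · exact card_eq_of_mul_eq_one hQP₁.2.2.2 hPQ₁.2.2.2

end Blocks

theorem mul_mul_mul_eq_one {F a b c : Type*} [DivisionRing F] [Fintype b] [Fintype c]
    [DecidableEq a] [DecidableEq b] {P : Matrix a b F} {P' : Matrix b a F} {Q : Matrix b c F}
    {Q' : Matrix c b F} (hP : P * P' = 1) (hQ : Q * Q' = 1) : (P * Q) * (Q' * P') = 1 := by
  rw [Matrix.mul_assoc, ← Matrix.mul_assoc Q, hQ, Matrix.one_mul, hP]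

theorem fromBlocks_one_mul_fromBlocks_one {F a b c : Type*} [DivisionRing F] [Fintype b]
    [Fintype c] [DecidableEq a] [DecidableEq c] {P : Matrix a b F} {P' : Matrix b a F}
    (hP : P * P' = 1) :
    (fromBlocks P 0 0 1 : Matrix (a ⊕ c) (b ⊕ c) F) *
      (fromBlocks P' 0 0 1 : Matrix (b ⊕ c) (a ⊕ c) F) = 1 := by
  simp [Matrix.fromBlocks_multiply, hP]

/-! ### Stages as block matrices, and invariance of the algorithm -/

section Stage

variable {F : Type*} [DivisionRing F] [StarRing F]

/-- Steps 1 and 2 over arbitrary index types. The rows of [M N] are independent because they are the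
upper rows of `S * A` times the invertible `Sᴴ`. -/
theorem stageBlocks_of_reduction {ι a α β γ : Type*} [Fintype ι] [DecidableEq ι] [Fintype a]
    [DecidableEq a] [Fintype α] [DecidableEq α] [Fintype β] [DecidableEq β] [Fintype γ]
    [DecidableEq γ] {A : Matrix ι ι F} {S : Matrix (a ⊕ γ) ι F} {S' : Matrix ι (a ⊕ γ) F}
    (hS' : S' * S = 1) (hS₁ : RowIndep (S * A).toRows₁)
    (hS₂ : (S * A).toRows₂ = 0) {R : Matrix (α ⊕ β) a F} {R' : Matrix a (α ⊕ β) F}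
    (hR : R * R' = 1) (hR' : R' * R = 1)
    (hR₁ : (R * (S * A * Sᴴ).toBlocks₁₂).toRows₁ = 0)
    (hR₂ : RowIndep (R * (S * A * Sᴴ).toBlocks₁₂).toRows₂) :
    ∃ (B : Matrix α β F) (C : Matrix β α F) (D : Matrix β β F) (E : Matrix β γ F),
      ((fromBlocks R 0 0 1 : Matrix ((α ⊕ β) ⊕ γ) (a ⊕ γ) F) * S) * A *
        ((fromBlocks R 0 0 1 : Matrix ((α ⊕ β) ⊕ γ) (a ⊕ γ) F) * S)ᴴ =
          stageBlocks (R * (S * A * Sᴴ).toBlocks₁₁ * Rᴴ).toBlocks₁₁ B C D E ∧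
      RowIndep (fromCols (fromBlocks (R * (S * A * Sᴴ).toBlocks₁₁ * Rᴴ).toBlocks₁₁ B C D)
        (fromRows (0 : Matrix α γ F) E)) ∧ RowIndep E := by
  set M := (S * A * Sᴴ).toBlocks₁₁ with hM
  set N := (S * A * Sᴴ).toBlocks₁₂ with hN
  have hrows : S * A * Sᴴ = fromBlocks M N 0 0 := by
    have h₀ : fromRows (S * A).toRows₁ 0 * Sᴴ = S * A * Sᴴ := by
      rw [← hS₂, Matrix.fromRows_toRows]
    conv_lhs => rw [← Matrix.fromBlocks_toBlocks (S * A * Sᴴ)]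
    rw [Matrix.fromBlocks_inj]
    refine ⟨rfl, rfl, ?_, ?_⟩
    · rw [← h₀, Matrix.fromRows_mul]; ext i j; simp [Matrix.toBlocks₂₁]
    · rw [← h₀, Matrix.fromRows_mul]; ext i j; simp [Matrix.toBlocks₂₂]
  have hRN : R * N = fromRows 0 (R * N).toRows₂ := by
    rw [← hR₁, Matrix.fromRows_toRows]
  refine ⟨(R * M * Rᴴ).toBlocks₁₂, (R * M * Rᴴ).toBlocks₂₁, (R * M * Rᴴ).toBlocks₂₂,
    (R * N).toRows₂, ?_, ?_, hR₂⟩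
  · rw [stageBlocks, Matrix.fromBlocks_toBlocks, ← hRN, Matrix.conjTranspose_mul]
    calc _ = (fromBlocks R 0 0 1 : Matrix ((α ⊕ β) ⊕ γ) (a ⊕ γ) F) * (S * A * Sᴴ) *
          (fromBlocks R 0 0 1 : Matrix ((α ⊕ β) ⊕ γ) (a ⊕ γ) F)ᴴ := by
          simp only [Matrix.mul_assoc]
      _ = _ := by
          rw [hrows]
          simp [Matrix.fromBlocks_multiply, Matrix.fromBlocks_conjTranspose]
  · have h₁ : RowIndep (fromCols M N) := by
      have : fromCols M N = (S * A).toRows₁ * Sᴴ := by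
        have h₂ := congrArg Matrix.toRows₁ hrows
        ext i (j | j)
        · exact (congrFun (congrFun h₂ i) (Sum.inl j)).symm
        · exact (congrFun (congrFun h₂ i) (Sum.inr j)).symm
      rw [this]
      exact hS₁.mul_right (conjTranspose_mul_eq_one hS')
    rw [Matrix.fromBlocks_toBlocks, ← hRN]
    have h₂ := (h₁.mul_left hR).mul_right
      (S := (fromBlocks Rᴴ 0 0 1 : Matrix (a ⊕ γ) ((α ⊕ β) ⊕ γ) F))
      (T := (fromBlocks R'ᴴ 0 0 1 : Matrix ((α ⊕ β) ⊕ γ) (a ⊕ γ) F))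
      (by simp [Matrix.fromBlocks_multiply, conjTranspose_mul_eq_one hR'])
    simpa [Matrix.mul_fromCols, Matrix.fromCols_mul_fromBlocks] using h₂

theorem IsStage.hasStageForm {r m₂ m₁ : ℕ}
    {A : Matrix (Fin (r + m₂ + m₁)) (Fin (r + m₂ + m₁)) F} {A₁ : Matrix (Fin r) (Fin r) F}
    (h : IsStage r m₂ m₁ A A₁) : HasStageForm (Fin m₂) (Fin m₁) A A₁ := by
  obtain ⟨S, hS, hS₁, hS₂, M, N, rfl, rfl, R, hR, hR₁, hR₂, rfl⟩ := h
  obtain ⟨S', hSS', hS'S⟩ := isUnit_iff_exists_inverse.1 hS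
  obtain ⟨R', hRR', hR'R⟩ := isUnit_iff_exists_inverse.1 hR
  let e₁ : Fin (r + m₂) ⊕ Fin m₁ ≃ Fin (r + m₂ + m₁) := finSumFinEquiv
  let e₂ : Fin r ⊕ Fin m₂ ≃ Fin (r + m₂) := finSumFinEquiv
  have hP : S.submatrix e₁ id * S'.submatrix id e₁ = 1 := by
    rw [← Matrix.submatrix_mul _ _ _ _ _ Function.bijective_id, hSS', Matrix.submatrix_one_equiv]
  have hP' : S'.submatrix id e₁ * S.submatrix e₁ id = 1 := by
    rw [← Matrix.submatrix_mul _ _ _ _ _ e₁.bijective, hS'S, Matrix.submatrix_id_id]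
  have hQ : R.submatrix e₂ id * R'.submatrix id e₂ = 1 := by
    rw [← Matrix.submatrix_mul _ _ _ _ _ Function.bijective_id, hRR', Matrix.submatrix_one_equiv]
  have hQ' : R'.submatrix id e₂ * R.submatrix e₂ id = 1 := by
    rw [← Matrix.submatrix_mul _ _ _ _ _ e₂.bijective, hR'R, Matrix.submatrix_id_id]
  obtain ⟨B, C, D, E, h₁, h₂, h₃⟩ := stageBlocks_of_reduction (A := A) hP' hS₁
    (by ext i j; exact congrFun (hS₂ i) j) hQ hQ'
    (by ext i j; exact congrFun (hR₁ i) j) hR₂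
  exact ⟨B, C, D, E, starCongruent_of_left _ _
    (mul_mul_mul_eq_one (fromBlocks_one_mul_fromBlocks_one hQ) hP)
    (mul_mul_mul_eq_one hP' (fromBlocks_one_mul_fromBlocks_one hQ')) h₁, h₂, h₃⟩

theorem Run.isUnit {n τ r : ℕ} {ms : List ℕ} {A : Matrix (Fin n) (Fin n) F}
    {B : Matrix (Fin r) (Fin r) F} (h : Run A τ ms B) : IsUnit B := by
  induction h with
  | done A hA => exact hA
  | step _ _ _ _ _ _ ih => exact ih

theorem Run.length_eq {n τ r : ℕ} {ms : List ℕ} {A : Matrix (Fin n) (Fin n) F}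
    {B : Matrix (Fin r) (Fin r) F} (h : Run A τ ms B) : ms.length = 2 * τ := by
  induction h with
  | done A hA => rfl
  | step _ _ _ _ _ _ ih => simp [ih]; ring

/-- *Congruence preserves nonsingularity, so two executions stop simultaneously; otherwise their
first stages agree by rigidity and the reduced matrices are again *congruent. -/
theorem Run.unique {n τ r : ℕ} {ms : List ℕ} {A : Matrix (Fin n) (Fin n) F}
    {B : Matrix (Fin r) (Fin r) F} (h : Run A τ ms B) :
    ∀ {n' τ' r' : ℕ} {ms' : List ℕ} {A' : Matrix (Fin n') (Fin n') F}
      {B' : Matrix (Fin r') (Fin r') F}, Run A' τ' ms' B' → StarCongruent A A' →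
      τ' = τ ∧ ms' = ms ∧ StarCongruent B B' := by
  induction h with
  | done A hA =>
    intro n' τ' r' ms' A' B' h' hc
    cases h' with
    | done => exact ⟨rfl, rfl, hc⟩
    | step A₁' A₂' B' hA' => exact absurd (hc.isUnit hA) hA'
  | step A A₁ B hA hstage hrun ih =>
    intro n' τ' r' ms' A' B' h' hc
    cases h' with
    | done A' hA' => exact absurd (hc.symm.isUnit hA') hA
    | step A' A₁' B' hA' hstage' hrun' =>
      obtain ⟨h₁, h₂, h₃⟩ := hstage.hasStageForm.unique hstage'.hasStageForm hc
      obtain ⟨rfl, rfl, h₄⟩ := ih hrun' h₁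
      simp only [Fintype.card_fin] at h₂ h₃
      exact ⟨rfl, by rw [h₂, h₃], h₄⟩

end Stage

/-- A class of nonsingular matrices which is closed under products, row permutations and direct
sums with identity matrices, and which is rich enough for row reduction. -/
structure ReductionClass (F : Type*) [DivisionRing F] where
  mem : ∀ {ι κ : Type} [Fintype ι] [DecidableEq ι] [Fintype κ] [DecidableEq κ],
    Matrix ι κ F → Prop
  exists_inverse : ∀ {ι κ : Type} [Fintype ι] [DecidableEq ι] [Fintype κ] [DecidableEq κ]
    {S : Matrix ι κ F}, mem S → ∃ T : Matrix κ ι F, S * T = 1 ∧ T * S = 1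
  one : ∀ {ι : Type} [Fintype ι] [DecidableEq ι], mem (1 : Matrix ι ι F)
  mul : ∀ {ι κ μ : Type} [Fintype ι] [DecidableEq ι] [Fintype κ] [DecidableEq κ] [Fintype μ]
    [DecidableEq μ] {S : Matrix ι κ F} {T : Matrix κ μ F}, mem S → mem T → mem (S * T)
  reindex : ∀ {ι ι' κ : Type} [Fintype ι] [DecidableEq ι] [Fintype κ] [DecidableEq κ] [Fintype ι']
    [DecidableEq ι'] {S : Matrix ι κ F} (e : ι' ≃ ι), mem S → mem (S.submatrix e id)
  fromBlocks_one : ∀ {ι κ γ : Type} [Fintype ι] [DecidableEq ι] [Fintype κ] [DecidableEq κ]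
    [Fintype γ] [DecidableEq γ] {S : Matrix ι κ F}, mem S →
    mem (fromBlocks S 0 0 1 : Matrix (ι ⊕ γ) (κ ⊕ γ) F)
  rowReduce : ∀ {ι κ : Type} [Fintype ι] [DecidableEq ι] [Fintype κ] [DecidableEq κ]
    (N : Matrix ι κ F), ∃ (k l : ℕ) (S : Matrix (Fin k ⊕ Fin l) ι F), mem S ∧
      RowIndep (S * N).toRows₁ ∧ (S * N).toRows₂ = 0

/-! ### Existence of an execution with transforming matrix in a given class -/

section Existence

variable {F : Type*} [DivisionRing F] [StarRing F]

theorem ReductionClass.exists_isStage (G : ReductionClass F) {n : ℕ}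
    (A : Matrix (Fin n) (Fin n) F) :
    ∃ (r m₂ m₁ : ℕ) (h : r + m₂ + m₁ = n) (A₁ : Matrix (Fin r) (Fin r) F),
      IsStage r m₂ m₁ (A.submatrix (finCongr h) (finCongr h)) A₁ ∧
      ∃ S : Matrix ((Fin r ⊕ Fin m₂) ⊕ Fin m₁) (Fin n) F, G.mem S ∧
        ∃ (B : Matrix (Fin r) (Fin m₂) F) (C : Matrix (Fin m₂) (Fin r) F)
          (D : Matrix (Fin m₂) (Fin m₂) F) (E : Matrix (Fin m₂) (Fin m₁) F),
          S * A * Sᴴ = stageBlocks A₁ B C D E ∧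
          RowIndep (fromCols (fromBlocks A₁ B C D) (fromRows (0 : Matrix (Fin r) (Fin m₁) F) E)) ∧
          RowIndep E := by
  obtain ⟨k, m₁, S, hS, hS₁, hS₂⟩ := G.rowReduce A
  obtain ⟨m₂, r, R₀, hR₀, hR₁, hR₂⟩ := G.rowReduce (S * A * Sᴴ).toBlocks₁₂
  -- Row reduction puts the independent rows on top, whereas Step 2 wants them at the bottom.
  have hR := G.reindex (Equiv.sumComm (Fin r) (Fin m₂)) hR₀
  set R := R₀.submatrix (Equiv.sumComm (Fin r) (Fin m₂)) id
  have hR₁' : RowIndep (R * (S * A * Sᴴ).toBlocks₁₂).toRows₂ := hR₁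
  have hR₂' : (R * (S * A * Sᴴ).toBlocks₁₂).toRows₁ = 0 := hR₂
  obtain ⟨S', hSS', hS'S⟩ := G.exists_inverse hS
  obtain ⟨R', hRR', hR'R⟩ := G.exists_inverse hR
  have hk : r + m₂ = k := by simpa using card_eq_of_mul_eq_one hRR' hR'R
  have hn : k + m₁ = n := by simpa using card_eq_of_mul_eq_one hSS' hS'S
  subst hk hn
  refine ⟨r, m₂, m₁, rfl, _, ?_, _, G.mul (G.fromBlocks_one hR) hS,
    stageBlocks_of_reduction hS'S hS₁ hS₂ hRR' hR'R hR₂' hR₁'⟩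
  let e₁ : Fin (r + m₂) ⊕ Fin m₁ ≃ Fin (r + m₂ + m₁) := finSumFinEquiv
  let e₂ : Fin r ⊕ Fin m₂ ≃ Fin (r + m₂) := finSumFinEquiv
  have he₁ : e₁.symm ∘ Fin.castAdd m₁ = Sum.inl := by ext i; simp [e₁]
  have he₁' : e₁.symm ∘ Fin.natAdd (r + m₂) = Sum.inr := by ext i; simp [e₁]
  have he₂ : e₂.symm ∘ Fin.castAdd m₂ = Sum.inl := by ext i; simp [e₂]
  have he₂' : e₂.symm ∘ Fin.natAdd r = Sum.inr := by ext i; simp [e₂]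
  have hunit : ∀ {a : ℕ} {b : Type} [Fintype b] [DecidableEq b] {P : Matrix b (Fin a) F}
      {Q : Matrix (Fin a) b F} (e : Fin a ≃ b), P * Q = 1 → Q * P = 1 →
      IsUnit (P.submatrix e id) := by
    intro a b _ _ P Q e h h'
    refine isUnit_iff_exists_inverse.2 ⟨Q.submatrix id e, ?_, ?_⟩
    · rw [← Matrix.submatrix_mul _ _ _ _ _ Function.bijective_id, h, Matrix.submatrix_one_equiv]
    · rw [← Matrix.submatrix_mul _ _ _ _ _ e.bijective, h', Matrix.submatrix_id_id]
  change IsStage r m₂ m₁ A _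
  refine ⟨S.submatrix e₁.symm id, hunit _ hSS' hS'S, ?_, ?_,
    (S * A * Sᴴ).toBlocks₁₁, (S * A * Sᴴ).toBlocks₁₂, ?_, ?_,
    R.submatrix e₂.symm id, hunit _ hRR' hR'R, ?_, ?_, ?_⟩
  · have : RowIndep ((S * A).submatrix (e₁.symm ∘ Fin.castAdd m₁) id) := by rw [he₁]; exact hS₁
    exact this
  · intro i
    have : (S * A).submatrix (e₁.symm ∘ Fin.natAdd (r + m₂)) id = 0 := by rw [he₁']; exact hS₂
    exact congrFun this i
  · have : (S * A * Sᴴ).toBlocks₁₁ = (S * A * Sᴴ).submatrix (e₁.symm ∘ Fin.castAdd m₁)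
      (e₁.symm ∘ Fin.castAdd m₁) := by rw [he₁]; rfl
    exact this
  · have : (S * A * Sᴴ).toBlocks₁₂ = (S * A * Sᴴ).submatrix (e₁.symm ∘ Fin.castAdd m₁)
      (e₁.symm ∘ Fin.natAdd (r + m₂)) := by rw [he₁, he₁']; rfl
    exact this
  · intro i
    have : (R * (S * A * Sᴴ).toBlocks₁₂).submatrix (e₂.symm ∘ Fin.castAdd m₂) id = 0 := by
      rw [he₂]; exact hR₂'
    exact congrFun this i
  · have : RowIndep ((R * (S * A * Sᴴ).toBlocks₁₂).submatrix (e₂.symm ∘ Fin.natAdd r) id) := by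
      rw [he₂']; exact hR₁'
    exact this
  · have : (R * (S * A * Sᴴ).toBlocks₁₁ * Rᴴ).toBlocks₁₁ =
      (R * (S * A * Sᴴ).toBlocks₁₁ * Rᴴ).submatrix (e₂.symm ∘ Fin.castAdd m₂)
        (e₂.symm ∘ Fin.castAdd m₂) := by rw [he₂]; rfl
    exact this

/-- The positions of a form with `τ + 1` stages, grouped by the first stage. -/
def stagePos {r τ m₁ m₂ : ℕ} {ms : List ℕ} :
    ((Fin r ⊕ Pos τ ms) ⊕ Fin m₂) ⊕ Fin m₁ → Fin r ⊕ Pos (τ + 1) (m₁ :: m₂ :: ms)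
  | .inl (.inl (.inl i)) => .inl i
  | .inl (.inl (.inr ⟨k, a⟩)) => .inr ⟨⟨k + 2, by omega⟩, a⟩
  | .inl (.inr b) => .inr ⟨⟨1, by omega⟩, b⟩
  | .inr c => .inr ⟨⟨0, by omega⟩, c⟩

theorem stagePos_bijective {r τ m₁ m₂ : ℕ} {ms : List ℕ} :
    Function.Bijective (stagePos (r := r) (τ := τ) (m₁ := m₁) (m₂ := m₂) (ms := ms)) := by
  constructor
  · rintro (((i | ⟨⟨k, hk⟩, a⟩) | b) | c) (((i' | ⟨⟨k', hk'⟩, a'⟩) | b') | c') h <;>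
      simp only [stagePos, Sum.inl.injEq, Sum.inr.injEq, reduceCtorEq] at h
    on_goal 1 => rw [h]
    all_goals
      have h₁ := congrArg (fun p => (p.1 : ℕ)) h
      have h₂ := (Sigma.mk.inj_iff.1 h).2
      simp only at h₁
      first
      | omega
      | (first | (obtain rfl : k = k' := by omega) | skip)
        rw [eq_of_heq h₂]
  · rintro (i | ⟨⟨k, hk⟩, a⟩)
    · exact ⟨.inl (.inl (.inl i)), rfl⟩
    · match k, hk, a with
      | 0, _, a => exact ⟨.inr a, rfl⟩
      | 1, _, a => exact ⟨.inl (.inr a), rfl⟩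
      | k + 2, hk, a => exact ⟨.inl (.inl (.inr ⟨⟨k, by omega⟩, a⟩)), rfl⟩

/-- `stagePos` as an equivalence. -/
noncomputable def stagePosEquiv (r τ m₁ m₂ : ℕ) (ms : List ℕ) :
    ((Fin r ⊕ Pos τ ms) ⊕ Fin m₂) ⊕ Fin m₁ ≃ Fin r ⊕ Pos (τ + 1) (m₁ :: m₂ :: ms) :=
  Equiv.ofBijective _ stagePos_bijective

/-- Parity is written as a remainder so that `omega` can settle the block patterns. -/
theorem blockKind_eq_zero_iff {τ i j : ℕ} : blockKind τ i j = .zero ↔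
    ¬ (i = j + 1 ∧ i ≤ 2 * τ) ∧
      ((i % 2 = 1 ∧ i < 2 * τ ∧ i ≤ j) ∨ (j % 2 = 1 ∧ j < 2 * τ ∧ j < i)) := by
  unfold blockKind
  simp only [Nat.odd_iff]
  split_ifs with h₁ h₂ h₃ <;> simp_all

theorem rowIndep_fromCols_of_stageBlocks {F α β γ : Type*} [DivisionRing F] [Fintype α]
    {K : Matrix α α F} {B : Matrix α β F}
    {C : Matrix β α F} {D : Matrix β β F} {E : Matrix β γ F}
    (h : RowIndep (fromCols (fromBlocks K B C D) (fromRows (0 : Matrix α γ F) E))) :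
    RowIndep (fromCols K B) := by
  have h₁ := h.comp Sum.inl_injective
  have h₂ : (fromCols (fromBlocks K B C D) (fromRows (0 : Matrix α γ F) E)).submatrix Sum.inl id
      = fromCols (fromCols K B) 0 := by
    ext i ((j | j) | j) <;> rfl
  rw [h₂] at h₁
  exact h₁.fromCols_of_right_zero rfl

theorem RowIndep.of_zero_rows {F ι κ κ' μ : Type*} [DivisionRing F] [Fintype μ]
    {Y : Matrix ι κ F} {B : Matrix ι κ' F} (h : RowIndep (fromCols Y B)) {f : μ → ι}
    (hf : Function.Injective f) (hY : ∀ a, Y (f a) = 0) : RowIndep (B.submatrix f id) := by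
  have h₁ := h.comp hf
  have h₂ : (fromCols Y B).submatrix f id = fromCols (Y.submatrix f id) (B.submatrix f id) := by
    ext i (j | j) <;> rfl
  rw [h₂] at h₁
  exact h₁.fromCols_of_left_zero (by ext i j; exact congrFun (hY i) j)

theorem stageBlocks_conj {α α' β γ : Type*} [Fintype α] [Fintype β] [DecidableEq β] [Fintype γ]
    [DecidableEq γ] (P : Matrix α' α F) (K : Matrix α α F) (B : Matrix α β F) (C : Matrix β α F)
    (D : Matrix β β F) (E : Matrix β γ F) :
    (fromBlocks (fromBlocks P 0 0 1) 0 0 1 : Matrix ((α' ⊕ β) ⊕ γ) ((α ⊕ β) ⊕ γ) F) *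
      stageBlocks K B C D E *
      (fromBlocks (fromBlocks P 0 0 1) 0 0 1 : Matrix ((α' ⊕ β) ⊕ γ) ((α ⊕ β) ⊕ γ) F)ᴴ =
    stageBlocks (P * K * Pᴴ) (P * B) (C * Pᴴ) D E := by
  simp [stageBlocks, Matrix.fromBlocks_multiply, Matrix.fromBlocks_conjTranspose,
    Matrix.fromBlocks_mul_fromRows]

theorem RowIndep.fromCols_conj {α α' β : Type*} [Fintype α] [Fintype α'] [Fintype β]
    [DecidableEq α] [DecidableEq α'] [DecidableEq β]
    {K : Matrix α α F} {B : Matrix α β F} (h : RowIndep (fromCols K B)) {P : Matrix α' α F}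
    {Q : Matrix α α' F} (hPQ : P * Q = 1) (hQP : Q * P = 1) :
    RowIndep (fromCols (P * K * Pᴴ) (P * B)) := by
  have := (h.mul_left hPQ).mul_right
    (fromBlocks_one_mul_fromBlocks_one (c := β) (conjTranspose_mul_eq_one hQP))
  simpa [Matrix.mul_fromCols, Matrix.fromCols_mul_fromBlocks] using this

theorem one_le_label {r τ : ℕ} {ms : List ℕ} (p : Fin r ⊕ Pos τ ms) : 1 ≤ label p := by
  rcases p with p | p <;> simp [label]

/-- Labels of `Y` shift by 2, which preserves parity and hence the zero pattern; the two new blocks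
get the labels 2 and 1. -/
theorem IsReducedForm.stage {F : Type*} [DivisionRing F] {r τ m₁ m₂ : ℕ} {ms : List ℕ}
    {B₀ : Matrix (Fin r) (Fin r) F}
    {Y : Matrix (Fin r ⊕ Pos τ ms) (Fin r ⊕ Pos τ ms) F} (hY : IsReducedForm τ ms B₀ Y)
    {B : Matrix (Fin r ⊕ Pos τ ms) (Fin m₂) F} {C : Matrix (Fin m₂) (Fin r ⊕ Pos τ ms) F}
    {D : Matrix (Fin m₂) (Fin m₂) F} {E : Matrix (Fin m₂) (Fin m₁) F}
    (hB : RowIndep (fromCols Y B)) (hE : RowIndep E)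
    {X : Matrix (Fin r ⊕ Pos (τ + 1) (m₁ :: m₂ :: ms)) (Fin r ⊕ Pos (τ + 1) (m₁ :: m₂ :: ms)) F}
    (hX : ∀ p q, X (stagePos p) (stagePos q) = stageBlocks Y B C D E p q) :
    IsReducedForm (τ + 1) (m₁ :: m₂ :: ms) B₀ X where
  regular_block := by
    rw [← hY.regular_block]
    ext i j
    exact hX (.inl (.inl (.inl i))) (.inl (.inl (.inl j)))
  regular := hY.regular
  zero_blocks := by
    have hlabel : ∀ x : Fin r ⊕ Pos τ ms,
        label (stagePos (m₁ := m₁) (m₂ := m₂) (.inl (.inl x))) = label x + 2 := by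
      rintro (x | ⟨k, a⟩)
      · simp only [stagePos, label]; ring
      · rfl
    have hlabel' : ∀ b : Fin m₂, label (stagePos (r := r) (τ := τ) (ms := ms) (m₁ := m₁)
        (.inl (.inr b))) = 2 := fun _ => rfl
    have hlabel'' : ∀ c : Fin m₁, label (stagePos (r := r) (τ := τ) (ms := ms) (m₂ := m₂)
        (.inr c)) = 1 := fun _ => rfl
    intro p q
    obtain ⟨p, rfl⟩ := stagePos_bijective.2 p
    obtain ⟨q, rfl⟩ := stagePos_bijective.2 q
    rw [hX]
    rcases p with (p | p) | p
    · have hp := one_le_label p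
      rcases q with (q | q) | q
      · rw [hlabel, hlabel]
        intro h
        refine hY.zero_blocks p q ?_
        rw [blockKind_eq_zero_iff] at h ⊢
        omega
      · rw [hlabel, hlabel', blockKind_eq_zero_iff]
        omega
      · intro
        rfl
    · rcases q with (q | q) | q
      · rw [hlabel, hlabel', blockKind_eq_zero_iff]
        omega
      · rw [hlabel', hlabel', blockKind_eq_zero_iff]
        omega
      · rw [hlabel', hlabel'', blockKind_eq_zero_iff]
        omega
    · intro
      rcases q with (q | q) | q <;> rfl
  independent_rows := by
    rintro ⟨i, hi⟩ ⟨j, hj⟩ hij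
    simp only at hij
    subst hij
    match j, hj, hi with
    | 0, _, _ =>
      have : ∀ a b, X (stagePos (.inl (.inr a))) (stagePos (.inr b)) = E a b := fun a b => hX _ _
      have h₁ : RowIndep (Matrix.of fun a b => X (stagePos (.inl (.inr a))) (stagePos (.inr b))) := by
        simp only [this]; exact hE
      exact h₁
    -- This is B_3. The rows of `Y` with label 1 are zero, so the independence of the rows of [Y B]
    -- there is carried by `B` alone.
    | 1, _, hi =>
      let f : Fin (entry ms 1) → Fin r ⊕ Pos τ ms := fun a => .inr ⟨⟨0, by omega⟩, a⟩
      have hf : Function.Injective f := by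
        intro a a' h
        exact eq_of_heq (Sigma.mk.inj_iff.1 (Sum.inr_injective h)).2
      have h₂ := hB.of_zero_rows hf (fun a => funext fun q => hY.zero_blocks _ _ (by
        have := one_le_label q
        have h₁ : label (f a) = 1 := rfl
        rw [h₁, blockKind_eq_zero_iff]
        omega))
      have h₁ : RowIndep (Matrix.of fun a b =>
          X (stagePos (.inl (.inl (f a)))) (stagePos (.inl (.inr b)))) := by
        simp only [hX]; exact h₂
      exact h₁
    | k + 2, hk, hk' =>
      have h₂ := hY.independent_rows ⟨k + 1, by omega⟩ ⟨k, by omega⟩ rfl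
      have h₁ : RowIndep (Matrix.of fun a b => X
          (stagePos (.inl (.inl (.inr ⟨⟨k + 1, by omega⟩, a⟩))))
          (stagePos (.inl (.inl (.inr ⟨⟨k, by omega⟩, b⟩))))) := by
        simp only [hX]; exact h₂
      exact h₁

theorem ReductionClass.exists_run (G : ReductionClass F) (n : ℕ) (A : Matrix (Fin n) (Fin n) F) :
    ∃ (τ : ℕ) (ms : List ℕ) (r : ℕ) (B : Matrix (Fin r) (Fin r) F)
      (S : Matrix (Fin r ⊕ Pos τ ms) (Fin n) F),
      G.mem S ∧ Run A τ ms B ∧ IsReducedForm τ ms B (S * A * Sᴴ) := by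
  induction n using Nat.strong_induction_on with
  | _ n ih =>
    by_cases hA : IsUnit A
    · have : IsEmpty (Pos 0 []) := ⟨fun p => p.1.elim0⟩
      let e : Fin n ⊕ Pos 0 [] ≃ Fin n := Equiv.sumEmpty _ _
      refine ⟨0, [], n, A, (1 : Matrix (Fin n) (Fin n) F).submatrix e id, G.reindex e G.one,
        .done A hA, ?_⟩
      have h₁ : (1 : Matrix (Fin n) (Fin n) F).submatrix e id * A *
          ((1 : Matrix (Fin n) (Fin n) F).submatrix e id)ᴴ = A.submatrix e e := by
        ext i j; simp [Matrix.mul_apply, Matrix.one_apply]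
      rw [h₁]
      refine ⟨by ext i j; rfl, hA, ?_, fun i => i.elim0⟩
      intro p q h
      rw [blockKind_eq_zero_iff] at h
      omega
    · obtain ⟨r₁, m₂, m₁, hn, A₁, hst, S₀, hS₀, B, C, D, E, hX, hrow, hE⟩ := G.exists_isStage A
      subst hn
      change IsStage r₁ m₂ m₁ A A₁ at hst
      -- If nothing were split off, all rows of `S * A` would be independent and `A` nonsingular.
      have hlt : r₁ < r₁ + m₂ + m₁ := by
        by_contra hcon
        obtain rfl : m₁ = 0 := by omega
        obtain rfl : m₂ = 0 := by omega
        obtain ⟨S, hS, hS₁, -⟩ := hst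
        apply hA
        have h₁ : IsUnit (S * A) := isUnit_of_rowIndep hS₁
        obtain ⟨u, rfl⟩ := hS
        exact (Units.isUnit_units_mul u A).1 h₁
      obtain ⟨τ, ms, r, B₀, S₁, hS₁, hrun, hred⟩ := ih r₁ hlt A₁
      obtain ⟨T₁, hST, hTS⟩ := G.exists_inverse hS₁
      let e := (stagePosEquiv r τ m₁ m₂ ms).symm
      refine ⟨τ + 1, m₁ :: m₂ :: ms, r, B₀, _, G.reindex e
        (G.mul (G.fromBlocks_one (γ := Fin m₁) (G.fromBlocks_one (γ := Fin m₂) hS₁)) hS₀),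
        .step A A₁ B₀ hA hst hrun, ?_⟩
      refine hred.stage ((rowIndep_fromCols_of_stageBlocks hrow).fromCols_conj hST hTS) hE
        (C := C * S₁ᴴ) (D := D) ?_
      intro p q
      rw [← stageBlocks_conj, ← hX]
      have he : ∀ p, e (stagePos p) = p := fun p =>
        (stagePosEquiv r τ m₁ m₂ ms).symm_apply_apply p
      set W := (fromBlocks (fromBlocks S₁ 0 0 1) 0 0 1 :
        Matrix (((Fin r ⊕ Pos τ ms) ⊕ Fin m₂) ⊕ Fin m₁) ((Fin r₁ ⊕ Fin m₂) ⊕ Fin m₁) F)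
      have h₁ : ((W * S₀) * A * (W * S₀)ᴴ).submatrix e e (stagePos p) (stagePos q) =
          (W * (S₀ * A * S₀ᴴ) * Wᴴ) p q := by
        rw [Matrix.submatrix_apply, he, he, Matrix.conjTranspose_mul]
        simp only [Matrix.mul_assoc]
      exact h₁

end Existence

/-! ### Row reduction by nonsingular matrices -/

section RowReduction

/-- A relation among the upper rows of `S * N` is a combination of upper rows of `S` in the left
kernel of `N`. The lower rows span that kernel, so independence of all rows of `S` makes the
relation trivial. -/
theorem rowIndep_toRows₁_mul {F a b ι κ : Type*} [DivisionRing F] [Fintype a]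
    [Fintype b] [Fintype ι]
    {S : Matrix (a ⊕ b) ι F} {N : Matrix ι κ F} (hS : RowIndep S)
    (h : ∀ x : ι → F, x ᵥ* N = 0 → ∃ w : b → F, x = w ᵥ* S.toRows₂) :
    RowIndep (S * N).toRows₁ := by
  rw [rowIndep_iff]
  intro v hv
  have h₁ : (v ᵥ* S.toRows₁) ᵥ* N = 0 := by
    rw [Matrix.vecMul_vecMul]; exact hv
  obtain ⟨w, hw⟩ := h _ h₁
  have h₂ := rowIndep_iff.1 hS (Sum.elim v (-w)) (by
    rw [← Matrix.fromRows_toRows S, Matrix.sumElim_vecMul_fromRows, hw, Matrix.neg_vecMul,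
      add_neg_cancel])
  ext i
  exact congrFun h₂ (.inl i)

/-- The class of all nonsingular matrices. -/
def unitsClass (F : Type*) [DivisionRing F] : ReductionClass F where
  mem {ι κ} _ _ _ _ S := ∃ T : Matrix κ ι F, S * T = 1 ∧ T * S = 1
  exists_inverse h := h
  one := ⟨1, by simp, by simp⟩
  mul := by
    rintro _ _ _ _ _ _ _ _ _ S T ⟨S', h₁, h₂⟩ ⟨T', h₃, h₄⟩
    exact ⟨T' * S', mul_mul_mul_eq_one h₁ h₃, mul_mul_mul_eq_one h₄ h₂⟩
  reindex := by
    rintro _ _ _ _ _ _ _ _ _ S e ⟨T, h₁, h₂⟩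
    refine ⟨T.submatrix id e, ?_, ?_⟩
    · rw [← Matrix.submatrix_mul _ _ _ _ _ Function.bijective_id, h₁, Matrix.submatrix_one_equiv]
    · rw [← Matrix.submatrix_mul _ _ _ _ _ e.bijective, h₂, Matrix.submatrix_id_id]
  fromBlocks_one := by
    rintro _ _ _ _ _ _ _ _ _ S ⟨T, h₁, h₂⟩
    exact ⟨_, fromBlocks_one_mul_fromBlocks_one h₁, fromBlocks_one_mul_fromBlocks_one h₂⟩
  rowReduce := by
    intro ι κ _ _ _ _ N
    -- The rows of `S` are a basis of a complement of the left kernel, followed by a basis of the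
    -- kernel.
    let K := LinearMap.ker N.vecMulLinear
    obtain ⟨C, hC⟩ := K.exists_isCompl
    let bK := Module.finBasis F K
    let bC := Module.finBasis F C
    let b := (bC.prod bK).map (Submodule.prodEquivOfIsCompl C K hC.symm)
    have hb₁ : ∀ i, b (.inl i) = bC i := by intro i; simp [b]
    have hb₂ : ∀ i, b (.inr i) = bK i := by intro i; simp [b]
    let S : Matrix (Fin (Module.finrank F C) ⊕ Fin (Module.finrank F K)) ι F := Matrix.of fun i => b i
    have hS : RowIndep S := b.linearIndependent
    refine ⟨_, _, S, exists_inverse_of_rowIndep hS ?_, rowIndep_toRows₁_mul hS ?_, ?_⟩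
    · rw [← Module.finrank_eq_card_basis b]; simp
    · intro x hx
      refine ⟨fun i => bK.repr ⟨x, hx⟩ i, ?_⟩
      have h₁ := congrArg Subtype.val (bK.sum_repr ⟨x, hx⟩)
      rw [Matrix.vecMul_eq_sum]
      simp only [Submodule.coe_sum, Submodule.coe_smul] at h₁
      refine h₁.symm.trans (Finset.sum_congr rfl fun i _ => ?_)
      rw [← hb₂]
      rfl
    · ext i j
      have h₁ : (bK i : ι → F) ᵥ* N = 0 := (bK i).2
      rw [← hb₂] at h₁
      exact congrFun h₁ j

end RowReduction

/-! ### Row reduction by unitary matrices -/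

section Unitary

/-- The class of unitary matrices. -/
def unitaryClass (𝕜 : Type*) [RCLike 𝕜] : ReductionClass 𝕜 where
  -- Here `ᴴ` always uses the conjugation of `𝕜`, even when the algorithm is run on ℂ with the
  -- identity involution.
  mem S := S * Sᴴ = 1 ∧ Sᴴ * S = 1
  exists_inverse h := ⟨_, h⟩
  one := by simp
  mul := by
    rintro _ _ _ _ _ _ _ _ _ S T ⟨h₁, h₂⟩ ⟨h₃, h₄⟩
    rw [Matrix.conjTranspose_mul]
    exact ⟨mul_mul_mul_eq_one h₁ h₃, mul_mul_mul_eq_one h₄ h₂⟩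
  reindex := by
    rintro _ _ _ _ _ _ _ _ _ S e ⟨h₁, h₂⟩
    rw [Matrix.conjTranspose_submatrix]
    refine ⟨?_, ?_⟩
    · rw [← Matrix.submatrix_mul _ _ _ _ _ Function.bijective_id, h₁, Matrix.submatrix_one_equiv]
    · rw [← Matrix.submatrix_mul _ _ _ _ _ e.bijective, h₂, Matrix.submatrix_id_id]
  fromBlocks_one := by
    rintro _ _ _ _ _ _ _ _ _ S ⟨h₁, h₂⟩
    simp [Matrix.fromBlocks_conjTranspose, Matrix.fromBlocks_multiply, h₁, h₂]
  rowReduce := by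
    intro ι κ _ _ _ _ N
    -- The left kernel of `N` again, now with its orthogonal complement and orthonormal bases.
    let K : Submodule 𝕜 (EuclideanSpace 𝕜 ι) :=
      LinearMap.ker (N.vecMulLinear ∘ₗ (WithLp.linearEquiv 2 𝕜 (ι → 𝕜)).toLinearMap)
    let bK := stdOrthonormalBasis 𝕜 K
    let bC := stdOrthonormalBasis 𝕜 Kᗮ
    let S : Matrix (Fin (Module.finrank 𝕜 Kᗮ) ⊕ Fin (Module.finrank 𝕜 K)) ι 𝕜 :=
      fromRows (Matrix.of fun i => WithLp.ofLp (bC i : EuclideanSpace 𝕜 ι))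
        (Matrix.of fun i => WithLp.ofLp (bK i : EuclideanSpace 𝕜 ι))
    have hin : ∀ x y : EuclideanSpace 𝕜 ι,
        ∑ k, x k * star (y k) = inner 𝕜 y x := by
      intro x y
      rw [PiLp.inner_apply]
      rfl
    have hS : S * Sᴴ = 1 := by
      ext (i | i) (j | j)
      · refine (hin (bC i) (bC j)).trans ?_
        rw [← Submodule.coe_inner, orthonormal_iff_ite.1 bC.orthonormal]
        simp only [Sum.inl.injEq, Matrix.one_apply, @eq_comm _ j i]
      · refine (hin (bC i) (bK j)).trans ?_
        rw [(bC i).2 _ (bK j).2]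
        simp
      · refine (hin (bK i) (bC j)).trans ?_
        rw [Submodule.inner_left_of_mem_orthogonal (bK i).2 (bC j).2]
        simp
      · refine (hin (bK i) (bK j)).trans ?_
        rw [← Submodule.coe_inner, orthonormal_iff_ite.1 bK.orthonormal]
        simp only [Sum.inr.injEq, Matrix.one_apply, @eq_comm _ j i]
    have hcard : Module.finrank 𝕜 Kᗮ + Module.finrank 𝕜 K = Fintype.card ι := by
      rw [add_comm, K.finrank_add_finrank_orthogonal]; simp
    refine ⟨_, _, S, ⟨hS, ?_⟩, rowIndep_toRows₁_mul (rowIndep_of_mul_eq_one hS) ?_, ?_⟩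
    · rwa [Matrix.mul_eq_one_comm_of_card_eq]
      simp [hcard]
    · intro x hx
      have hx' : WithLp.toLp 2 x ∈ K := hx
      refine ⟨fun i => bK.repr ⟨_, hx'⟩ i, ?_⟩
      have h₁ := congrArg (fun y : K => WithLp.ofLp (y : EuclideanSpace 𝕜 ι))
        (bK.sum_repr ⟨_, hx'⟩)
      rw [Matrix.vecMul_eq_sum]
      simp only [Submodule.coe_sum, Submodule.coe_smul, WithLp.ofLp_sum, WithLp.ofLp_smul] at h₁
      exact h₁.symm
    · ext i j
      have h₁ : (WithLp.ofLp (bK i : EuclideanSpace 𝕜 ι)) ᵥ* N = 0 := (bK i).2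
      exact congrFun h₁ j

end Unitary

/-! ### The unitarily reduced form of a given execution -/

section ReducedForm

theorem exists_antitone_equiv {κ : Type*} [Fintype κ] {n : ℕ} (h : Fintype.card κ = n)
    (f : κ → ℕ) : ∃ e : Fin n ≃ κ, ∀ x y, x ≤ y → f (e y) ≤ f (e x) := by
  let e₀ : Fin n ≃ κ := (Fintype.equivFinOfCardEq h).symm
  let g : Fin n → ℕᵒᵈ := fun x => OrderDual.toDual (f (e₀ x))
  exact ⟨(Tuple.sort g).trans e₀, fun x y hxy => Tuple.monotone_sort g hxy⟩

theorem IsReducedForm.skeleton_eq {F : Type*} [DivisionRing F] {r τ : ℕ} {ms : List ℕ}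
    {B : Matrix (Fin r) (Fin r) F} {X : Matrix (Fin r ⊕ Pos τ ms) (Fin r ⊕ Pos τ ms) F}
    (h : IsReducedForm τ ms B X) : skeleton X = sparseForm F τ ms := by
  ext p q
  have hp := p.1.2
  have hz := h.zero_blocks (.inr p) (.inr q)
  simp only [skeleton, sparseForm, Matrix.of_apply, label] at hz ⊢
  by_cases hpq : (p.1 : ℕ) = q.1 + 1
  · have hk : blockKind τ (p.1 + 1) (q.1 + 1) = .dist := by
      rw [blockKind, if_pos]; omega
    rw [hk]
    simp [hpq]
  · rw [if_neg (c := (p.1 : ℕ) = q.1 + 1 ∧ (p.2 : ℕ) = q.2) (fun h => hpq h.1)]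
    have hk : blockKind τ (p.1 + 1) (q.1 + 1) ≠ .dist := by
      rw [blockKind, if_neg (by omega)]
      split_ifs <;> simp
    cases hb : blockKind τ (p.1 + 1) (q.1 + 1) with
    | zero => exact hz hb
    | star => rfl
    | dist => exact absurd hb hk

theorem ReductionClass.exists_reducedForm {F : Type*} [DivisionRing F] [StarRing F]
    (G : ReductionClass F) {n τ r : ℕ} {ms : List ℕ} {A : Matrix (Fin n) (Fin n) F}
    {Aτ : Matrix (Fin r) (Fin r) F} (hrun : Run A τ ms Aτ) :
    ∃ P : Matrix (Fin n) (Fin n) F, G.mem P ∧ ∃ (e : Fin n ≃ Fin r ⊕ Pos τ ms)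
      (B : Matrix (Fin r) (Fin r) F),
      (∀ x y, x ≤ y → label (e y) ≤ label (e x)) ∧
      IsReducedForm τ ms B (Matrix.reindex e e (P * A * Pᴴ)) ∧
      StarCongruent B Aτ ∧
      skeleton (Matrix.reindex e e (P * A * Pᴴ)) = sparseForm F τ ms := by
  obtain ⟨τ', ms', r', B, S, hS, hrun', hred⟩ := G.exists_run n A
  -- The execution inside the class need not be the given one; invariance identifies the numbers and
  -- relates the regular parts by *congruence.
  obtain ⟨rfl, rfl, hB⟩ := hrun.unique hrun' (StarCongruent.refl A)
  obtain ⟨S', hSS', hS'S⟩ := G.exists_inverse hS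
  have hr : r = r' := by
    obtain ⟨U, V, hU, hV, -⟩ := hB
    simpa using card_eq_of_mul_eq_one hU hV
  subst hr
  obtain ⟨e, he⟩ := exists_antitone_equiv
    (by simpa using card_eq_of_mul_eq_one hSS' hS'S) (label (r := r) (τ := τ') (ms := ms'))
  have hX : Matrix.reindex e e (S.submatrix e id * A * (S.submatrix e id)ᴴ) = S * A * Sᴴ := by
    have : S.submatrix e id * A * (S.submatrix e id)ᴴ = (S * A * Sᴴ).submatrix e e := rfl
    rw [this]
    simp
  refine ⟨S.submatrix e id, G.reindex e hS, e, B, he, ?_⟩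
  rw [hX]
  exact ⟨hred, hB.symm, hred.skeleton_eq⟩

end ReducedForm

/-! ### The canonical sparse form -/

section SparseForm

/-- The `p × q` matrix `[I 0]`. -/
def rectOne (F : Type*) [DivisionRing F] (p q : ℕ) : Matrix (Fin p) (Fin q) F :=
  Matrix.of fun i j => if (i : ℕ) = j then 1 else 0

theorem rectOne_mul_transpose {F : Type*} [DivisionRing F] {p q : ℕ} (h : p ≤ q) :
    rectOne F p q * (rectOne F p q)ᵀ = 1 := by
  ext i j
  rw [Matrix.mul_apply, Finset.sum_eq_single (Fin.castLE h i)]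
  · simp [rectOne, Matrix.one_apply, Fin.ext_iff, eq_comm]
  · intro k _ hk
    have : (i : ℕ) ≠ k := fun h => hk (Fin.ext h.symm)
    simp [rectOne, this]
  · simp

/-- Complete the rows of `E` to a basis, forming `T`. Since `E` consists of the first rows of `T`,
multiplying by the inverse of `T` gives [I 0]. -/
theorem RowIndep.exists_mul_eq_rectOne {F : Type*} [DivisionRing F] {p q : ℕ}
    {E : Matrix (Fin p) (Fin q) F} (hE : RowIndep E) :
    p ≤ q ∧ ∃ R T : Matrix (Fin q) (Fin q) F, R * T = 1 ∧ T * R = 1 ∧ E * R = rectOne F p q := by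
  obtain ⟨C, hC⟩ := (Submodule.span F (Set.range fun i => E i)).exists_isCompl
  obtain ⟨c, b, hb⟩ : ∃ (c : ℕ) (b : Module.Basis (Fin p ⊕ Fin c) F (Fin q → F)),
      ∀ i, b (.inl i) = E i := by
    refine ⟨_, ((Module.Basis.span hE).prod (Module.finBasis F C)).map
      (Submodule.prodEquivOfIsCompl _ C hC), fun i => ?_⟩
    simp [Module.Basis.span_apply]
  have hcard : p + c = q := by
    simpa using (Module.finrank_eq_card_basis b).symm
  subst hcard
  let T : Matrix (Fin p ⊕ Fin c) (Fin (p + c)) F := Matrix.of fun i => b i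
  obtain ⟨R, hTR, hRT⟩ := exists_inverse_of_rowIndep (M := T) b.linearIndependent (by simp)
  let e : Fin (p + c) ≃ Fin p ⊕ Fin c := finSumFinEquiv.symm
  refine ⟨by omega, R.submatrix id e, T.submatrix e id, ?_, ?_, ?_⟩
  · rw [← Matrix.submatrix_mul _ _ _ _ _ e.bijective, hRT, Matrix.submatrix_id_id]
  · rw [← Matrix.submatrix_mul _ _ _ _ _ Function.bijective_id, hTR, Matrix.submatrix_one_equiv]
  · have hE' : E = T.submatrix Sum.inl id := by
      ext i j; exact (congrFun (hb i) j).symm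
    rw [hE', ← Matrix.submatrix_mul _ _ _ _ _ Function.bijective_id, hTR]
    ext i j
    obtain ⟨j, rfl⟩ := e.symm.surjective j
    rcases j with j | j
    · simp [rectOne, Matrix.one_apply, e, Fin.ext_iff]
    · have : (i : ℕ) ≠ p + j := by omega
      simp [rectOne, e, this]

variable {F : Type*} [DivisionRing F] [StarRing F]

/-- The block column of `B` is modified by that of `K` and by `W`. The matching row operations reach
only the middle block row, so `K` and the zero above `E` survive. -/
theorem stageBlocks_change {α β γ : Type*} [Fintype α] [DecidableEq α] [Fintype β]
    [DecidableEq β] [Fintype γ] [DecidableEq γ] (K : Matrix α α F) (B : Matrix α β F)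
    (C : Matrix β α F) (D : Matrix β β F) (E : Matrix β γ F) (Q : Matrix α β F)
    {W W' : Matrix β β F} (h : W * W' = 1) (h' : W' * W = 1) :
    ∃ C' D', StarCongruent (stageBlocks K B C D E)
      (stageBlocks K ((K * Q + B) * W) C' D' (Wᴴ * E)) := by
  refine ⟨(Q * W)ᴴ * K + Wᴴ * C,
    ((Q * W)ᴴ * K + Wᴴ * C) * (Q * W) + ((Q * W)ᴴ * B + Wᴴ * D) * W,
    fromBlocks (fromBlocks 1 (Q * W) 0 W) 0 0 1,
    fromBlocks (fromBlocks 1 (-Q) 0 W') 0 0 1, ?_, ?_, ?_⟩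
  · simp [Matrix.fromBlocks_multiply, Matrix.mul_assoc, h]
  · simp [Matrix.fromBlocks_multiply, h']
  · simp only [stageBlocks, Matrix.fromBlocks_conjTranspose, Matrix.fromBlocks_multiply,
      Matrix.fromBlocks_mul_fromRows, Matrix.mul_zero, Matrix.zero_mul, add_zero, zero_add,
      Matrix.conjTranspose_zero, Matrix.conjTranspose_one, Matrix.one_mul, Matrix.mul_one,
      Matrix.add_mul, Matrix.mul_assoc]

/-- The right inverse of `E` lets the last block column cancel `C` and `D`; the matching row
operations only add multiples of zero rows. -/
theorem stageBlocks_clear {α β γ : Type*} [Fintype α] [DecidableEq α] [Fintype β]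
    [DecidableEq β] [Fintype γ] [DecidableEq γ] (K : Matrix α α F) (B : Matrix α β F)
    (C : Matrix β α F) (D : Matrix β β F) {E : Matrix β γ F} {G : Matrix γ β F} (hG : E * G = 1)
    {R R' : Matrix γ γ F} (h : R * R' = 1) (h' : R' * R = 1) :
    StarCongruent (stageBlocks K B C D E) (stageBlocks K B 0 0 (E * R)) := by
  refine ⟨fromBlocks 1 0 (fromCols (-(G * C)) (-(G * D))) R,
    fromBlocks 1 0 (-(R' * fromCols (-(G * C)) (-(G * D)))) R', ?_, ?_, ?_⟩
  · generalize fromCols (-(G * C)) (-(G * D)) = L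
    simp [Matrix.fromBlocks_multiply, ← Matrix.mul_assoc, h]
  · generalize fromCols (-(G * C)) (-(G * D)) = L
    simp [Matrix.fromBlocks_multiply, h']
  · simp [stageBlocks, Matrix.fromBlocks_conjTranspose, Matrix.fromBlocks_multiply,
      Matrix.fromRows_mul, Matrix.fromBlocks_add,
      ← Matrix.mul_assoc, hG]

/-- As m_{k+1} ≤ m_k, each [I 0] has its transpose as right inverse, so N Nᵀ is the projection that
kills exactly the positions with label 1. -/
theorem sparseForm_mul_transpose {F : Type*} [DivisionRing F] {τ : ℕ} {ms : List ℕ}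
    (hms : ∀ k, 1 ≤ k → entry ms (k + 1) ≤ entry ms k) (p q : Pos τ ms) :
    (sparseForm F τ ms * (sparseForm F τ ms)ᵀ) p q = if p = q ∧ (p.1 : ℕ) ≠ 0 then 1 else 0 := by
  obtain ⟨⟨k, hk⟩, a⟩ := p
  obtain ⟨⟨l, hl⟩, b⟩ := q
  rw [Matrix.mul_apply]
  match k, hk, a with
  | 0, hk, a =>
    simp [sparseForm]
  | k + 1, hk, a =>
    have hle : entry ms (k + 1 + 1) ≤ entry ms (k + 1) := hms _ (by omega)
    rw [Finset.sum_eq_single ⟨⟨k, by omega⟩, Fin.castLE hle a⟩]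
    · by_cases hkl : l = k + 1
      · subst hkl
        simp [sparseForm, Fin.ext_iff, eq_comm]
      · have : ¬ ((⟨⟨k + 1, hk⟩, a⟩ : Pos τ ms) = ⟨⟨l, hl⟩, b⟩) := by
          intro h
          exact hkl (congrArg (fun p => (p.1 : ℕ)) h).symm
        simp [sparseForm, this, hkl]
    · rintro ⟨⟨l', hl'⟩, c⟩ _ hne
      have : ¬ (k = l' ∧ (a : ℕ) = c) := by
        rintro ⟨rfl, h⟩
        exact hne (by congr 1; exact Fin.ext h.symm)
      simp [sparseForm, this]
    · simp

theorem stageBlocks_sparseForm {F : Type*} [DivisionRing F] {s τ m₁ m₂ : ℕ} {ms : List ℕ}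
    (Aτ : Matrix (Fin s) (Fin s) F)
    {P : Matrix (Fin s ⊕ Pos τ ms) (Fin m₂) F} (hP₁ : ∀ i, P (.inl i) = 0)
    (hP₂ : ∀ p b, P (.inr p) b = if (p.1 : ℕ) = 0 ∧ (p.2 : ℕ) = b then 1 else 0) :
    (directSum Aτ (sparseForm F (τ + 1) (m₁ :: m₂ :: ms))).submatrix
      (stagePosEquiv s τ m₁ m₂ ms) (stagePosEquiv s τ m₁ m₂ ms) =
    stageBlocks (directSum Aτ (sparseForm F τ ms)) P 0 0 (rectOne F m₂ m₁) := by
  ext p q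
  have he : ∀ p, stagePosEquiv s τ m₁ m₂ ms p = stagePos p := fun _ => rfl
  have h₁ : 1 % (2 * (τ + 1)) = 1 := Nat.mod_eq_of_lt (by omega)
  rw [Matrix.submatrix_apply, he, he]
  rcases p with ((p | p) | p) | p <;> rcases q with ((q | q) | q) | q <;>
    simp [stagePos, sparseForm, stageBlocks, rectOne, hP₁, hP₂, h₁]

theorem exists_sparseForm_of_stageBlocks {s τ m₁ m₂ : ℕ} {ms : List ℕ}
    (hlen : ms.length = 2 * τ)
    (hms : ∀ k, 1 ≤ k → entry ms (k + 1) ≤ entry ms k)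
    {Aτ : Matrix (Fin s) (Fin s) F} (hA : IsUnit Aτ)
    {B : Matrix (Fin s ⊕ Pos τ ms) (Fin m₂) F} (C : Matrix (Fin m₂) (Fin s ⊕ Pos τ ms) F)
    (D : Matrix (Fin m₂) (Fin m₂) F) {E : Matrix (Fin m₂) (Fin m₁) F}
    (hB : RowIndep (fromCols (directSum Aτ (sparseForm F τ ms)) B)) (hE : RowIndep E) :
    m₂ ≤ m₁ ∧ entry ms 1 ≤ m₂ ∧
      StarCongruent (stageBlocks (directSum Aτ (sparseForm F τ ms)) B C D E)
        (directSum Aτ (sparseForm F (τ + 1) (m₁ :: m₂ :: ms))) := by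
  set N := sparseForm F τ ms with hN
  set K := directSum Aτ N with hK
  -- For the empty list `entry ms 1` is 0 by default; otherwise the block with label 1 really
  -- exists.
  have hpos : 0 < entry ms 1 → 0 < 2 * τ := by
    intro h
    rw [← hlen]
    rcases ms with _ | ⟨m, ms⟩
    · exact absurd h (by simp [entry])
    · simp
  let f : Fin (entry ms 1) → Fin s ⊕ Pos τ ms := fun a =>
    .inr ⟨⟨0, hpos (by have := a.2; omega)⟩, a⟩
  have hf : Function.Injective f := by
    intro a a' h
    exact eq_of_heq (Sigma.mk.inj_iff.1 (Sum.inr_injective h)).2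
  have hK₀ : ∀ a, K (f a) = 0 := by
    intro a
    ext (q | q)
    · rfl
    · simp [hK, hN, f, sparseForm]
  -- The rows of `K` with label 1 vanish, so those of `B` are independent; this bounds their number
  -- by m₂ and makes them [I 0].
  obtain ⟨hle, W, W', hWW', hW'W, hW⟩ := (hB.of_zero_rows hf hK₀).exists_mul_eq_rectOne
  obtain ⟨A', hAA', -⟩ := isUnit_iff_exists_inverse.1 hA
  -- Minus a partial right inverse of `K`, applied to `B`: in K Q + B only the rows with label 1
  -- remain.
  let Q : Matrix (Fin s ⊕ Pos τ ms) (Fin m₂) F :=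
    -((fromBlocks A' 0 0 Nᵀ : Matrix (Fin s ⊕ Pos τ ms) (Fin s ⊕ Pos τ ms) F) * B)
  have hKQ : K * Q + B =
      B - (fromBlocks 1 0 0 (N * Nᵀ) : Matrix (Fin s ⊕ Pos τ ms) (Fin s ⊕ Pos τ ms) F) * B := by
    simp only [Q, hK, Matrix.mul_neg, ← Matrix.mul_assoc, Matrix.fromBlocks_multiply,
      Matrix.mul_zero, Matrix.zero_mul, add_zero, zero_add, hAA']
    rw [neg_add_eq_sub]
  obtain ⟨C', D', hc⟩ := stageBlocks_change K B C D E Q hWW' hW'W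
  have hWE : RowIndep (Wᴴ * E) := hE.mul_left (conjTranspose_mul_eq_one hW'W)
  obtain ⟨hle', R, R', hRR', hR'R, hR⟩ := hWE.exists_mul_eq_rectOne
  refine ⟨hle', hle, hc.trans ((stageBlocks_clear _ _ _ _ (G := R * (rectOne F m₂ m₁)ᵀ)
    (by rw [← Matrix.mul_assoc, hR, rectOne_mul_transpose hle']) hRR' hR'R).trans ?_)⟩
  rw [hR, ← stageBlocks_sparseForm]
  · exact (starCongruent_submatrix _ _).symm
  · intro i
    have h₁ : (K * Q + B) (.inl i) = 0 := by
      rw [hKQ]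
      ext j
      simp [Matrix.mul_apply, Matrix.fromBlocks, Matrix.one_apply]
    ext j
    rw [Matrix.mul_apply, h₁]
    simp
  · intro p b
    have h₁ : ∀ j, (K * Q + B) (.inr p) j = if (p.1 : ℕ) = 0 then B (.inr p) j else 0 := by
      intro j
      rw [hKQ, Matrix.sub_apply, Matrix.mul_apply]
      simp only [Fintype.sum_sum_type, Matrix.fromBlocks_apply₂₁, Matrix.fromBlocks_apply₂₂,
        Matrix.zero_apply, zero_mul, Finset.sum_const_zero, zero_add, hN,
        sparseForm_mul_transpose hms]
      by_cases hp : (p.1 : ℕ) = 0 <;> simp [hp]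
    rw [Matrix.mul_apply]
    simp only [h₁]
    obtain ⟨⟨k, hk⟩, a⟩ := p
    match k, hk, a with
    | 0, hk, a =>
      have h₂ := congrFun (congrFun hW a) b
      rw [Matrix.mul_apply] at h₂
      simpa [rectOne] using h₂
    | k + 1, hk, a => simp

theorem Run.sparseForm {n τ r : ℕ} {ms : List ℕ} {A : Matrix (Fin n) (Fin n) F}
    {Aτ : Matrix (Fin r) (Fin r) F} (h : Run A τ ms Aτ) :
    (∀ k, 1 ≤ k → entry ms (k + 1) ≤ entry ms k) ∧
      StarCongruent A (directSum Aτ (sparseForm F τ ms)) := by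
  induction h with
  | @done n A hA =>
    have : IsEmpty (Pos 0 []) := ⟨fun p => p.1.elim0⟩
    refine ⟨fun k hk => by simp [entry], ?_⟩
    let e : Fin n ⊕ Pos 0 [] ≃ Fin n := Equiv.sumEmpty _ _
    have h₁ : directSum A (Regularization.sparseForm F 0 []) = A.submatrix e e := by
      ext (i | i) (j | j)
      · rfl
      · exact isEmptyElim j
      · exact isEmptyElim i
      · exact isEmptyElim i
    rw [h₁]
    exact starCongruent_submatrix A e
  | step A A₁ B hA hstage hrun ih =>
    obtain ⟨hms, hc⟩ := ih
    obtain ⟨B₁, C, D, E, hX, hrow, hE⟩ := hstage.hasStageForm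
    obtain ⟨P, Q, hPQ, hQP, hP, -⟩ := hc.exists_left
    have hB := (rowIndep_fromCols_of_stageBlocks hrow).fromCols_conj hPQ hQP
    rw [hP] at hB
    obtain ⟨h₁, h₂, h₃⟩ := exists_sparseForm_of_stageBlocks hrun.length_eq hms hrun.isUnit
      (C * Pᴴ) D hB hE
    refine ⟨?_, hX.trans (StarCongruent.trans ?_ h₃)⟩
    · intro k hk
      match k, hk with
      | 1, _ => exact h₁
      | 2, _ => exact h₂
      | k + 3, _ => exact hms (k + 1) (by omega)
    · refine starCongruent_of_left _ _
        (fromBlocks_one_mul_fromBlocks_one (fromBlocks_one_mul_fromBlocks_one hPQ))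
        (fromBlocks_one_mul_fromBlocks_one (fromBlocks_one_mul_fromBlocks_one hQP)) ?_
      rw [stageBlocks_conj, hP]

end SparseForm

/-! ### Direct sums of Jordan blocks under one stage -/

section JordanSum

/-- The direct sum of the Jordan blocks of sizes `d i`; empty blocks are allowed. -/
def jordanFamily (F : Type*) [DivisionRing F] {I : Type*} [DecidableEq I] (d : I → ℕ) :
    Matrix (Σ i, Fin (d i)) (Σ i, Fin (d i)) F :=
  Matrix.blockDiagonal' fun i => jordanBlock F (d i)

theorem jordanFamily_apply {F I : Type*} [DivisionRing F] [DecidableEq I] (d : I → ℕ)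
    (p q : Σ i, Fin (d i)) :
    jordanFamily F d p q = if p.1 = q.1 ∧ (p.2 : ℕ) + 1 = q.2 then 1 else 0 := by
  obtain ⟨i, x⟩ := p
  obtain ⟨j, y⟩ := q
  by_cases h : i = j
  · subst h
    simp [jordanFamily, jordanBlock]
  · simp [jordanFamily, h, Matrix.blockDiagonal'_apply]

theorem jordanFamily_mul_transpose {F I : Type*} [DivisionRing F] [Fintype I] [DecidableEq I]
    (d : I → ℕ) (p q : Σ i, Fin (d i)) :
    (jordanFamily F d * (jordanFamily F d)ᵀ) p q =
      if p = q ∧ (p.2 : ℕ) + 1 < d p.1 then 1 else 0 := by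
  obtain ⟨i, x⟩ := p
  obtain ⟨j, y⟩ := q
  rw [Matrix.mul_apply]
  simp only [Matrix.transpose_apply, jordanFamily_apply]
  by_cases hx : (x : ℕ) + 1 < d i
  · rw [Finset.sum_eq_single ⟨i, ⟨x + 1, hx⟩⟩]
    · by_cases hij : j = i
      · subst hij
        simp [hx, Fin.ext_iff, eq_comm]
      · have : ¬ ((⟨i, x⟩ : Σ i, Fin (d i)) = ⟨j, y⟩) := fun h =>
          hij (congrArg Sigma.fst h).symm
        simp [hij, this]
    · rintro ⟨k, z⟩ _ hne
      have : ¬ (i = k ∧ (x : ℕ) + 1 = z) := by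
        rintro ⟨rfl, h⟩
        exact hne (by congr 1; exact Fin.ext h.symm)
      simp only [this, if_false, zero_mul]
    · simp
  · rw [if_neg (fun h => hx h.2)]
    refine Finset.sum_eq_zero ?_
    rintro ⟨k, z⟩ _
    have : ¬ (i = k ∧ (x : ℕ) + 1 = z) := by
      rintro ⟨rfl, h⟩
      exact hx (h ▸ z.2)
    simp only [this, if_false, zero_mul]

variable {F : Type*} [DivisionRing F] [StarRing F]

theorem jordanFamily_starCongruent {I I' : Type*} [Fintype I] [DecidableEq I] [Fintype I']
    [DecidableEq I'] {d : I → ℕ} {d' : I' → ℕ} (e : I ≃ I') (h : ∀ i, d' (e i) = d i) :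
    StarCongruent (jordanFamily F d) (jordanFamily F d') := by
  obtain rfl : d = fun i => d' (e i) := funext fun i => (h i).symm
  have h₁ : jordanFamily F (fun i => d' (e i)) =
      (jordanFamily F d').submatrix (Equiv.sigmaCongrLeft (β := fun i => Fin (d' i)) e)
        (Equiv.sigmaCongrLeft (β := fun i => Fin (d' i)) e) := by
    ext p q
    rw [Matrix.submatrix_apply, jordanFamily_apply, jordanFamily_apply]
    simp [Equiv.sigmaCongrLeft]
  rw [h₁]
  exact (starCongruent_submatrix _ _).symm

/-- The positions of a direct sum with Jordan blocks, grouped by the stage of the algorithm. -/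
def jordanPos {α I : Type*} (d : I → ℕ) :
    ((α ⊕ Σ i, Fin (d i - 2)) ⊕ {i // 2 ≤ d i}) ⊕ {i // 1 ≤ d i} → α ⊕ Σ i, Fin (d i)
  | .inl (.inl (.inl a)) => .inl a
  | .inl (.inl (.inr ⟨i, x⟩)) => .inr ⟨i, ⟨x, by omega⟩⟩
  | .inl (.inr ⟨i, h⟩) => .inr ⟨i, ⟨d i - 2, by omega⟩⟩
  | .inr ⟨i, h⟩ => .inr ⟨i, ⟨d i - 1, by omega⟩⟩

theorem jordanPos_bijective {α I : Type*} (d : I → ℕ) :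
    Function.Bijective (jordanPos (α := α) d) := by
  constructor
  · rintro (((a | ⟨i, x⟩) | ⟨i, hi⟩) | ⟨i, hi⟩) (((a' | ⟨i', x'⟩) | ⟨i', hi'⟩) | ⟨i', hi'⟩) h <;>
      simp only [jordanPos, Sum.inl.injEq, Sum.inr.injEq, reduceCtorEq] at h
    on_goal 1 => rw [h]
    all_goals
      obtain rfl : i = i' := congrArg Sigma.fst h
      have h₁ := Fin.ext_iff.1 (eq_of_heq (Sigma.mk.inj_iff.1 h).2)
      simp only at h₁
      first
      | rfl
      | omega
      | rw [Fin.ext h₁]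
  · rintro (a | ⟨i, ⟨x, hx⟩⟩)
    · exact ⟨.inl (.inl (.inl a)), rfl⟩
    · by_cases h₁ : x + 1 = d i
      · refine ⟨.inr ⟨i, by omega⟩, ?_⟩
        have : d i - 1 = x := by omega
        simp [jordanPos, this]
      · by_cases h₂ : x + 2 = d i
        · refine ⟨.inl (.inr ⟨i, by omega⟩), ?_⟩
          have : d i - 2 = x := by omega
          simp [jordanPos, this]
        · exact ⟨.inl (.inl (.inr ⟨i, ⟨x, by omega⟩⟩)), rfl⟩

/-- The last row of each nonempty block is zero, and the row before it meets only the last column.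
Setting these two positions aside leaves `B` and blocks of size `d i - 2`; truncated subtraction and
empty blocks keep the index set `I` fixed for induction. -/
theorem hasStageForm_directSum_jordanFamily {α I : Type*} [Fintype α] [DecidableEq α] [Fintype I]
    [DecidableEq I] {B : Matrix α α F} (hB : IsUnit B) (d : I → ℕ) :
    HasStageForm {i // 2 ≤ d i} {i // 1 ≤ d i} (directSum B (jordanFamily F d))
      (directSum B (jordanFamily F fun i => d i - 2)) := by
  let g : ((α ⊕ Σ i, Fin (d i - 2)) ⊕ {i // 2 ≤ d i}) ⊕ {i // 1 ≤ d i} ≃ α ⊕ Σ i, Fin (d i) :=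
    Equiv.ofBijective _ (jordanPos_bijective d)
  have hg : ∀ p, g p = jordanPos d p := fun _ => rfl
  -- The one entry of each longer block that links the shortened block to the penultimate position.
  let L : Matrix (α ⊕ Σ i, Fin (d i - 2)) {i // 2 ≤ d i} F := Matrix.of fun p b =>
    p.elim (fun _ => 0) fun p => if p.1 = b.1 ∧ (p.2 : ℕ) + 1 = d p.1 - 2 then 1 else 0
  let E : Matrix {i // 2 ≤ d i} {i // 1 ≤ d i} F := Matrix.of fun b c =>
    if (b : I) = c then 1 else 0
  have hX : (directSum B (jordanFamily F d)).submatrix g g =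
      stageBlocks (directSum B (jordanFamily F fun i => d i - 2)) L 0 0 E := by
    ext p q
    rw [Matrix.submatrix_apply, hg, hg]
    rcases p with ((a | ⟨i, x⟩) | ⟨i, hi⟩) | ⟨i, hi⟩ <;>
      rcases q with ((a' | ⟨i', x'⟩) | ⟨i', hi'⟩) | ⟨i', hi'⟩ <;>
      simp [jordanPos, jordanFamily_apply, stageBlocks, L, E]
    all_goals
      by_cases h : i = i'
      · subst h
        first
        | rfl
        | (intro; omega)
        | (have : d i - 2 + 1 = d i - 1 := by omega
           simp [this])
      · simp [h]
  refine ⟨L, 0, 0, E, hX ▸ starCongruent_submatrix _ g, ?_, ?_⟩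
  · obtain ⟨B', hBB', -⟩ := isUnit_iff_exists_inverse.1 hB
    have h₁ : RowIndep ((directSum B (jordanFamily F d)).submatrix (g ∘ Sum.inl) id) := by
      -- J Jᵀ is the identity away from the last row of each block, so transposes supply a right
      -- inverse.
      refine rowIndep_of_mul_eq_one
        (B := (directSum B' (jordanFamily F d)ᵀ).submatrix id (g ∘ Sum.inl)) ?_
      rw [← Matrix.submatrix_mul _ _ _ _ _ Function.bijective_id, Matrix.fromBlocks_multiply]
      simp only [Matrix.mul_zero, Matrix.zero_mul, add_zero, zero_add, hBB']
      ext p q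
      have h₂ : (1 : Matrix ((α ⊕ Σ i, Fin (d i - 2)) ⊕ {i // 2 ≤ d i})
          ((α ⊕ Σ i, Fin (d i - 2)) ⊕ {i // 2 ≤ d i}) F) p q =
          if jordanPos d (.inl p) = jordanPos d (.inl q) then 1 else 0 := by
        rw [Matrix.one_apply]
        congr 1
        exact propext ((jordanPos_bijective d).1.eq_iff.trans Sum.inl_injective.eq_iff).symm
      rw [h₂, Matrix.submatrix_apply]
      simp only [Function.comp, hg]
      clear h₂
      generalize jordanPos d (.inl q) = q
      rcases p with (a | ⟨i, x⟩) | ⟨i, hi⟩ <;> rcases q with a' | q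
      · simp [jordanPos, Matrix.one_apply]
      · simp [jordanPos]
      · simp [jordanPos]
      · have : (x : ℕ) + 1 < d i := by omega
        simp [jordanPos, jordanFamily_mul_transpose, this]
      · simp [jordanPos]
      · have : d i - 2 + 1 < d i := by omega
        simp [jordanPos, jordanFamily_mul_transpose, this]
    have h₂ := h₁.reindex Function.injective_id g
    have h₃ : fromCols (fromBlocks (directSum B (jordanFamily F fun i => d i - 2)) L 0 0)
        (fromRows 0 E) =
        (stageBlocks (directSum B (jordanFamily F fun i => d i - 2)) L 0 0 E).submatrix
          Sum.inl id := by
      ext p (q | q) <;> rfl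
    rw [h₃, ← hX]
    exact h₂
  · refine rowIndep_of_mul_eq_one (B := Eᵀ) ?_
    ext b b'
    rw [Matrix.mul_apply, Finset.sum_eq_single ⟨b.1, by have := b.2; omega⟩]
    · simp [E, Matrix.one_apply, Subtype.ext_iff, eq_comm]
    · intro c _ hc
      have : ¬ ((b : I) = c) := fun h => hc (Subtype.ext h.symm)
      simp [E, this]
    · simp

end JordanSum

/-! ### The integers m_k as block counts -/

section Uniqueness

variable {F : Type*} [DivisionRing F] [StarRing F]

theorem eq_zero_of_isUnit_directSum_jordanFamily {F α I : Type*} [DivisionRing F] [Fintype α]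
    [DecidableEq α] [Fintype I] [DecidableEq I] {B : Matrix α α F} {d : I → ℕ}
    (h : IsUnit (directSum B (jordanFamily F d))) (i : I) : d i = 0 := by
  by_contra hi
  obtain ⟨T, hT, -⟩ := isUnit_iff_exists_inverse.1 h
  let p : α ⊕ Σ i, Fin (d i) := .inr ⟨i, ⟨d i - 1, by omega⟩⟩
  have h₀ : directSum B (jordanFamily F d) p = 0 := by
    ext (q | ⟨j, y⟩)
    · rfl
    · simp only [p, Matrix.fromBlocks_apply₂₂, jordanFamily_apply, Pi.zero_apply]
      rw [if_neg]
      rintro ⟨rfl, hy⟩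
      have := y.2
      omega
  have h₁ := congrFun (congrFun hT p) p
  rw [Matrix.mul_apply, h₀] at h₁
  simp at h₁

theorem Run.unique_jordanFamily {n τ r : ℕ} {ms : List ℕ} {A : Matrix (Fin n) (Fin n) F}
    {Aτ : Matrix (Fin r) (Fin r) F} (h : Run A τ ms Aτ) {s : ℕ} {B : Matrix (Fin s) (Fin s) F}
    (hB : IsUnit B) {I : Type} [Fintype I] [DecidableEq I] (d : I → ℕ)
    (hc : StarCongruent A (directSum B (jordanFamily F d))) :
    StarCongruent B Aτ ∧ ∀ k, 1 ≤ k → entry ms k = Fintype.card {i // k ≤ d i} := by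
  induction h generalizing d with
  | done A hA =>
    have hd := eq_zero_of_isUnit_directSum_jordanFamily (hc.isUnit hA)
    have : IsEmpty (Σ i, Fin (d i)) := ⟨fun p => by have := p.2.2; have := hd p.1; omega⟩
    constructor
    · let e : Fin s ⊕ (Σ i, Fin (d i)) ≃ Fin s := Equiv.sumEmpty _ _
      have h₁ : directSum B (jordanFamily F d) = B.submatrix e e := by
        ext (i | i) (j | j)
        · rfl
        · exact isEmptyElim j
        · exact isEmptyElim i
        · exact isEmptyElim i
      rw [h₁] at hc
      exact (hc.trans (starCongruent_submatrix B e).symm).symm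
    · intro k hk
      have : IsEmpty {i // k ≤ d i} := ⟨fun i => by have := i.2; have := hd i.1; omega⟩
      obtain ⟨k, rfl⟩ : ∃ l, k = l + 1 := ⟨k - 1, by omega⟩
      rw [Fintype.card_eq_zero]
      rfl
  | step A A₁ B₀ hA hstage hrun ih =>
    obtain ⟨h₁, h₂, h₃⟩ := hstage.hasStageForm.unique
      (hasStageForm_directSum_jordanFamily hB d) hc
    rw [Fintype.card_fin] at h₂ h₃
    obtain ⟨h₄, h₅⟩ := ih _ h₁
    refine ⟨h₄, fun k hk => ?_⟩
    match k, hk with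
    | 1, _ => exact h₃
    | 2, _ => exact h₂
    | k + 3, _ =>
      -- After a stage the sizes are `d i - 2`, and k + 1 ≤ d i - 2 is equivalent to k + 3 ≤ d i,
      -- even with truncation.
      refine (h₅ (k + 1) (by omega)).trans (Fintype.card_congr (Equiv.subtypeEquivRight ?_))
      intro i
      omega

end Uniqueness

/-! ### Recovering multiplicities from the counts -/

section Sizes

theorem card_get_eq_count (l : List ℕ) (k : ℕ) :
    Fintype.card {i : Fin l.length // l.get i = k} = l.count k := by
  rw [Fintype.card_subtype]
  exact Fin.card_filter_univ_eq_vector_get_eq_count k (⟨l, rfl⟩ : List.Vector ℕ l.length)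

theorem count_jordanSizes (τ : ℕ) (ms : List ℕ) (k : ℕ) : (jordanSizes τ ms).count k =
    if 1 ≤ k ∧ k ≤ 2 * τ then entry ms k - entry ms (k + 1) else 0 := by
  have h : (jordanSizes τ ms).count k = ∑ l ∈ Finset.range (2 * τ),
      if l + 1 = k then entry ms (l + 1) - entry ms (l + 2) else 0 := by
    rw [jordanSizes, List.count_flatMap]
    simp only [Function.comp_def, List.count_replicate, beq_iff_eq]
    rfl
  rw [h]
  split_ifs with hk
  · obtain ⟨k, rfl⟩ : ∃ l, k = l + 1 := ⟨k - 1, by omega⟩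
    rw [Finset.sum_eq_single k]
    · simp
    · intro l _ hl
      rw [if_neg (by omega)]
    · intro hl
      exact absurd (Finset.mem_range.2 (by omega)) hl
  · refine Finset.sum_eq_zero fun l hl => ?_
    rw [Finset.mem_range] at hl
    rw [if_neg (by omega)]

theorem card_eq_count_jordanSizes {I : Type*} [Fintype I] {τ : ℕ} {ms : List ℕ} {d : I → ℕ}
    (hlen : ms.length = 2 * τ) (hpos : ∀ i, 1 ≤ d i)
    (hd : ∀ k, 1 ≤ k → entry ms k = Fintype.card {i // k ≤ d i}) (k : ℕ) :
    Fintype.card {i // d i = k} = (jordanSizes τ ms).count k := by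
  rw [count_jordanSizes]
  have hsplit : Fintype.card {i // k ≤ d i} =
      Fintype.card {i // d i = k} + Fintype.card {i // k + 1 ≤ d i} := by
    classical
    simp only [Fintype.card_subtype]
    rw [← Finset.card_union_of_disjoint]
    · congr 1
      ext i
      simp only [Finset.mem_filter, Finset.mem_univ, true_and, Finset.mem_union]
      omega
    · rw [Finset.disjoint_filter]
      intros
      omega
  split_ifs with hk
  · rw [hd k hk.1, hd (k + 1) (by omega), hsplit]
    omega
  -- Outside 1, …, 2τ there are no blocks: positivity of the sizes excludes 0, and `entry` vanishes
  -- past the end of the list.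
  · by_cases hk₀ : k = 0
    · have : IsEmpty {i // d i = k} := ⟨fun i => by have := i.2; have := hpos i.1; omega⟩
      simp
    · have h₁ := hd k (by omega)
      have h₂ : entry ms k = 0 := by
        obtain ⟨l, rfl⟩ : ∃ l, k = l + 1 := ⟨k - 1, by omega⟩
        exact List.getD_eq_default _ _ (by omega)
      omega

end Sizes

/-! ### From the sparse form to Jordan blocks -/

section JordanForm

variable {F : Type*} [DivisionRing F] [StarRing F]

theorem jordanFamily_starCongruent_jordanSum {I : Type*} [Fintype I] [DecidableEq I] {τ : ℕ}
    {ms : List ℕ} {d : I → ℕ}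
    (hlen : ms.length = 2 * τ) (hpos : ∀ i, 1 ≤ d i)
    (hd : ∀ k, 1 ≤ k → entry ms k = Fintype.card {i // k ≤ d i}) :
    StarCongruent (jordanFamily F d) (jordanSum F (jordanSizes τ ms)) := by
  have h : ∀ k, Nonempty ({i // d i = k} ≃
      {i : Fin (jordanSizes τ ms).length // (jordanSizes τ ms).get i = k}) := by
    intro k
    refine ⟨Fintype.equivOfCardEq ?_⟩
    rw [card_eq_count_jordanSizes hlen hpos hd, card_get_eq_count]
  exact jordanFamily_starCongruent (Equiv.ofFiberEquiv fun k => (h k).some)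
    (Equiv.ofFiberEquiv_map _)

theorem Pos.ext {τ : ℕ} {ms : List ℕ} {p q : Pos τ ms} (h₁ : (p.1 : ℕ) = q.1)
    (h₂ : (p.2 : ℕ) = q.2) : p = q := by
  obtain ⟨⟨k, hk⟩, a⟩ := p
  obtain ⟨⟨l, hl⟩, b⟩ := q
  obtain rfl : k = l := h₁
  obtain rfl : a = b := Fin.ext h₂
  rfl

/-- In N each position points to the one with the same inner index and the next lower label. Fixing
the inner index a < m₁ gives a chain, hence a Jordan block, so a permutation suffices. -/
theorem sparseForm_starCongruent_jordanSum {τ : ℕ} {ms : List ℕ} (hlen : ms.length = 2 * τ)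
    (hms : ∀ k, 1 ≤ k → entry ms (k + 1) ≤ entry ms k) :
    StarCongruent (sparseForm F τ ms) (jordanSum F (jordanSizes τ ms)) := by
  have hanti : ∀ k l, k ≤ l → entry ms (l + 1) ≤ entry ms (k + 1) := by
    intro k l hkl
    induction l, hkl using Nat.le_induction with
    | base => exact le_rfl
    | succ l _ ih => exact (hms _ (by omega)).trans ih
  have hzero : entry ms (2 * τ + 1) = 0 := List.getD_eq_default _ _ (by omega)
  -- `d` is the length of the chain through `a`: by monotonicity the labels k with a < m_k form an
  -- initial segment.
  have hex : ∀ a : ℕ, ∃ d, ∀ k, k < d ↔ a < entry ms (k + 1) := by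
    intro a
    have hex : ∃ k, ¬ a < entry ms (k + 1) := ⟨2 * τ, by omega⟩
    refine ⟨Nat.find hex, fun k => ⟨fun hk => not_not.1 (Nat.find_min hex hk), fun hk => ?_⟩⟩
    by_contra hcon
    have := hanti _ k (not_lt.1 hcon)
    exact Nat.find_spec hex (by omega)
  choose d hd using hex
  have hdτ : ∀ a, d a ≤ 2 * τ := by
    intro a
    by_contra hcon
    have := (hd a (2 * τ)).1 (by omega)
    omega
  let D : Fin (entry ms 1) → ℕ := fun a => d a
  have hD₁ : ∀ a, 1 ≤ D a := fun a => (hd a 0).2 a.2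
  refine StarCongruent.trans ?_ (jordanFamily_starCongruent_jordanSum (d := D) hlen hD₁ ?_)
  · have hpos : ∀ p : Pos τ ms, (p.1 : ℕ) < d p.2 := fun p => (hd _ _).2 p.2.2
    have hpos' : ∀ p : Σ a, Fin (D a), d p.1 - 1 - p.2 < d p.1 := fun p => by
      have := p.2.2
      have : 1 ≤ d p.1 := hD₁ p.1
      omega
    -- Labels fall along a chain while Jordan positions rise, hence the reversal d - 1 - x.
    let e : (Σ a, Fin (D a)) ≃ Pos τ ms :=
      { toFun := fun p => ⟨⟨d p.1 - 1 - p.2, (hpos' p).trans_le (hdτ _)⟩,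
          ⟨p.1, (hd _ _).1 (hpos' p)⟩⟩
        invFun := fun p => ⟨⟨p.2, p.2.2.trans_le (hanti 0 _ (Nat.zero_le _))⟩,
          ⟨d p.2 - 1 - p.1, by have := hpos p; simp only [D]; omega⟩⟩
        left_inv := by
          rintro ⟨a, x⟩
          have hx : (x : ℕ) < d a := x.2
          have : d a - 1 - (d a - 1 - x) = x := by omega
          simp [this]
        right_inv := by
          rintro ⟨k, a⟩
          have hx : (k : ℕ) < d a := hpos ⟨k, a⟩
          exact Pos.ext (Nat.sub_sub_self (Nat.le_sub_one_of_lt hx)) rfl }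
    have h₁ : (sparseForm F τ ms).submatrix e e = jordanFamily F D := by
      ext ⟨a, x⟩ ⟨b, y⟩
      have hx : (x : ℕ) < d a := x.2
      have hy : (y : ℕ) < d b := y.2
      rw [Matrix.submatrix_apply, jordanFamily_apply]
      simp only [sparseForm, Matrix.of_apply, e, Equiv.coe_fn_mk]
      congr 1
      apply propext
      constructor
      · rintro ⟨h, hab⟩
        obtain rfl : a = b := Fin.ext hab
        exact ⟨rfl, by omega⟩
      · rintro ⟨rfl, h⟩
        exact ⟨by omega, rfl⟩
    rw [← h₁]
    exact starCongruent_submatrix _ _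
  · intro k hk
    obtain ⟨k, rfl⟩ : ∃ l, k = l + 1 := ⟨k - 1, by omega⟩
    rw [← Fintype.card_fin (entry ms (k + 1))]
    refine Fintype.card_congr ⟨fun a => ⟨⟨a, a.2.trans_le (hanti 0 _ (Nat.zero_le _))⟩,
      Nat.succ_le_of_lt ((hd a k).2 a.2)⟩, fun a => ⟨a.1, (hd a.1 k).1 a.2⟩, fun _ => rfl,
      fun _ => rfl⟩

theorem Run.perm_jordanSizes {n τ r : ℕ} {ms : List ℕ} {A : Matrix (Fin n) (Fin n) F}
    {Aτ : Matrix (Fin r) (Fin r) F} (h : Run A τ ms Aτ) {s : ℕ} {B : Matrix (Fin s) (Fin s) F}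
    {ds : List ℕ} (hB : IsUnit B) (hds : ∀ d ∈ ds, 1 ≤ d)
    (hc : StarCongruent A (directSum B (jordanSum F ds))) :
    StarCongruent B Aτ ∧ ds.Perm (jordanSizes τ ms) := by
  obtain ⟨h₁, h₂⟩ := h.unique_jordanFamily hB ds.get hc
  refine ⟨h₁, List.perm_iff_count.2 fun k => ?_⟩
  rw [← card_get_eq_count, card_eq_count_jordanSizes h.length_eq (fun i => hds _ (ds.get_mem i)) h₂]

end JordanForm

end Regularization

theorem mainTheorem1 :
    -- the algorithm, invariance, and parts (a), (b), (c)
    (∀ (F : Type*) [DivisionRing F] [StarRing F] (n : ℕ) (A : Matrix (Fin n) (Fin n) F),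
      ¬ IsUnit A →
      (∃ (τ : ℕ) (ms : List ℕ) (r : ℕ) (Aτ : Matrix (Fin r) (Fin r) F), Run A τ ms Aτ) ∧
      ∀ (τ : ℕ) (ms : List ℕ) (r : ℕ) (Aτ : Matrix (Fin r) (Fin r) F), Run A τ ms Aτ →
        IsUnit Aτ ∧
        ms.length = 2 * τ ∧
        (∀ k, 1 ≤ k → entry ms (k + 1) ≤ entry ms k) ∧
        (∀ A' : Matrix (Fin n) (Fin n) F, StarCongruent A A' →
          ∀ (τ' : ℕ) (ms' : List ℕ) (r' : ℕ) (Aτ' : Matrix (Fin r') (Fin r') F),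
            Run A' τ' ms' Aτ' → τ' = τ ∧ ms' = ms ∧ StarCongruent Aτ Aτ') ∧
        StarCongruent A (directSum Aτ (sparseForm F τ ms)) ∧
        StarCongruent A (directSum Aτ (jordanSum F (jordanSizes τ ms))) ∧
        (∀ (s : ℕ) (B : Matrix (Fin s) (Fin s) F) (ds : List ℕ),
          IsUnit B → (∀ d ∈ ds, 1 ≤ d) → StarCongruent A (directSum B (jordanSum F ds)) →
            StarCongruent B Aτ ∧ ds.Perm (jordanSizes τ ms))) ∧
    -- part (d), the complex field with complex conjugation
    (∀ (n : ℕ) (A : Matrix (Fin n) (Fin n) ℂ), ¬ IsUnit A →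
      ∀ (τ : ℕ) (ms : List ℕ) (r : ℕ) (Aτ : Matrix (Fin r) (Fin r) ℂ), Run A τ ms Aτ →
        ∃ U ∈ Matrix.unitaryGroup (Fin n) ℂ, ∃ (e : Fin n ≃ Fin r ⊕ Pos τ ms)
          (B : Matrix (Fin r) (Fin r) ℂ),
          (∀ x y, x ≤ y → label (e y) ≤ label (e x)) ∧
          IsReducedForm τ ms B (Matrix.reindex e e (Uᴴ * A * U)) ∧
          StarCongruent B Aτ ∧
          skeleton (Matrix.reindex e e (Uᴴ * A * U)) = sparseForm ℂ τ ms) ∧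
    -- part (d), the complex field with the identity involution
    (∀ (n : ℕ) (A : Matrix (Fin n) (Fin n) ℂ), ¬ IsUnit A →
      ∀ (τ : ℕ) (ms : List ℕ) (r : ℕ) (Aτ : Matrix (Fin r) (Fin r) ℂ),
        @Run ℂ _ starRingOfComm n A τ ms r Aτ →
        ∃ V ∈ Matrix.unitaryGroup (Fin n) ℂ, ∃ (e : Fin n ≃ Fin r ⊕ Pos τ ms)
          (B : Matrix (Fin r) (Fin r) ℂ),
          (∀ x y, x ≤ y → label (e y) ≤ label (e x)) ∧
          IsReducedForm τ ms B (Matrix.reindex e e (Vᵀ * A * V)) ∧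
          @StarCongruent ℂ _ starRingOfComm _ _ _ _ _ _ B Aτ ∧
          skeleton (Matrix.reindex e e (Vᵀ * A * V)) = sparseForm ℂ τ ms) ∧
    -- part (d), the real field with the identity involution
    (∀ (n : ℕ) (A : Matrix (Fin n) (Fin n) ℝ), ¬ IsUnit A →
      ∀ (τ : ℕ) (ms : List ℕ) (r : ℕ) (Aτ : Matrix (Fin r) (Fin r) ℝ), Run A τ ms Aτ →
        ∃ Q ∈ Matrix.orthogonalGroup (Fin n) ℝ, ∃ (e : Fin n ≃ Fin r ⊕ Pos τ ms)
          (B : Matrix (Fin r) (Fin r) ℝ),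
          (∀ x y, x ≤ y → label (e y) ≤ label (e x)) ∧
          IsReducedForm τ ms B (Matrix.reindex e e (Qᵀ * A * Q)) ∧
          StarCongruent B Aτ ∧
          skeleton (Matrix.reindex e e (Qᵀ * A * Q)) = sparseForm ℝ τ ms) := by
  refine ⟨?_, ?_, ?_, ?_⟩
  · intro F _ _ n A hA
    constructor
    · obtain ⟨τ, ms, r, B, -, -, hrun, -⟩ := (unitsClass F).exists_run n A
      exact ⟨τ, ms, r, B, hrun⟩
    · intro τ ms r Aτ hrun
      obtain ⟨hms, hc⟩ := hrun.sparseForm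
      exact ⟨hrun.isUnit, hrun.length_eq, hms,
        fun A' hA' τ' ms' r' Aτ' hrun' => hrun.unique hrun' hA', hc,
        hc.trans ((StarCongruent.refl Aτ).directSum
          (sparseForm_starCongruent_jordanSum hrun.length_eq hms)),
        fun s B ds hB hds hc' => hrun.perm_jordanSizes hB hds hc'⟩
  · intro n A _ τ ms r Aτ hrun
    obtain ⟨P, hP, e, B, he, h₁, h₂, h₃⟩ := (unitaryClass ℂ).exists_reducedForm hrun
    refine ⟨Pᴴ, ?_, e, B, he, ?_⟩
    · rw [Matrix.mem_unitaryGroup_iff, Matrix.star_eq_conjTranspose,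
        Matrix.conjTranspose_conjTranspose]
      exact hP.2
    · rw [Matrix.conjTranspose_conjTranspose]
      exact ⟨h₁, h₂, h₃⟩
  · intro n A _ τ ms r Aτ hrun
    -- Two involutions meet: the algorithm uses the identity, so its congruence is P A Pᵀ, while `P`
    -- is unitary for conjugation.
    obtain ⟨P, hP, e, B, he, h₁, h₂, h₃⟩ :=
      @ReductionClass.exists_reducedForm ℂ _ starRingOfComm (unitaryClass ℂ) _ _ _ _ _ _ hrun
    refine ⟨Pᵀ, ?_, e, B, he, ?_⟩
    · have h : star Pᵀ = Pᴴᵀ := rfl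
      rw [Matrix.mem_unitaryGroup_iff', h, ← Matrix.transpose_mul, hP.1, Matrix.transpose_one]
    · rw [Matrix.transpose_transpose]
      exact ⟨h₁, h₂, h₃⟩
  · intro n A _ τ ms r Aτ hrun
    obtain ⟨P, hP, e, B, he, h₁, h₂, h₃⟩ := (unitaryClass ℝ).exists_reducedForm hrun
    rw [Matrix.conjTranspose_eq_transpose_of_trivial] at h₁ h₃
    refine ⟨Pᵀ, ?_, e, B, he, ?_⟩
    · rw [Matrix.mem_orthogonalGroup_iff, Matrix.transpose_transpose,
        ← Matrix.conjTranspose_eq_transpose_of_trivial]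
      exact hP.2
    · rw [Matrix.transpose_transpose]
      exact ⟨h₁, h₂, h₃⟩
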